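/- All graphs are finite and simple. A $k$-tree is a graph obtained from a complete graph of order $k+1$ by repeatedly adding vertices of degree $k$ whose neighborhood is a clique; the tree-width of $G$ is the smallest integer $k\ge 0$ such that $G$ is a subgraph of a $k$-tree. The odd-girth (girth) of $G$ is the length of a shortest odd cycle (shortest cycle) of $G$, and $\infty$ if there is none. For integers $p\ge q\ge 1$, a $(p,q)$-coloring of $G$ is a map $c:V(G)\to\{0,\dots,p-1\}$ with $q\le |c(u)-c(v)|\le p-q$ for all adjacent $u,v$; the circular chromatic number $\chi_c(G)$ is the infimum of the ratios $p/q$ over all such $(p,q)$ for which $G$ has a $(p,q)$-coloring. **Theorem.** (1) For every integer $k\ge 0$ and every real $\varepsilon>0$ there is an integer $g$ such that every graph $G$ with tree-width at most $k$ and odd-girth at least $g$ satisfies $\chi_c(G)\le 2+\varepsilon$. (2) Equivalently, for every integer $k\ge 0$ and all positive integers $p,q$ with $p/q>2$ there is an integer $g$ such that every graph with tree-width at most $k$ and odd-girth at least $g$ has a $(p,q)$-coloring. (3) Consequently (Nešetřil–Zhu), for every integer $k\ge 0$ and every real $\varepsilon>0$ there is an integer $g$ such that every graph $G$ that has tree-width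 at most $k$ and admits a homomorphism to a graph $H$ of girth at least $g$ satisfies $\chi_c(G)\le 2+\varepsilon$. -/

import Mathlib

universe u v

namespace SimpleGraph

/-- `G` is a `k`-tree: it is obtained from a complete graph of order `k + 1` by repeatedly adding
vertices of degree `k` whose neighbourhood is a clique. (Every `k`-tree is finite.) -/
inductive IsKTree (k : ℕ) : {V : Type u} → SimpleGraph V → Prop
  | complete {V : Type u} (hcard : Nat.card V = k + 1) : IsKTree k (⊤ : SimpleGraph V)
  | add {V : Type u} (G : SimpleGraph V) (v : V)
      (hG : IsKTree k (G.induce ({v}ᶜ : Set V)))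
      (hdeg : (G.neighborSet v).ncard = k)
      (hclique : G.IsClique (G.neighborSet v)) : IsKTree k G

/-- `G` is a partial `k`-tree: a subgraph (not necessarily spanning) of some `k`-tree. -/
def IsPartialKTree {V : Type u} (G : SimpleGraph V) (k : ℕ) : Prop :=
  ∃ (W : Type u) (T : SimpleGraph W), IsKTree k T ∧ G.IsContained T

/-- The tree-width of `G`: the smallest `k` such that `G` is a subgraph of a `k`-tree
(`⊤` if there is none, which does not happen for finite graphs). -/
noncomputable def treeWidth {V : Type u} (G : SimpleGraph V) : ℕ∞ :=
  ⨅ (k : ℕ) (_ : G.IsPartialKTree k), (k : ℕ∞)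

/-- The odd-girth of `G`: the length of a shortest odd cycle (`⊤` if there is none). -/
noncomputable def oddGirth {V : Type u} (G : SimpleGraph V) : ℕ∞ :=
  ⨅ (a : V) (w : G.Walk a a) (_ : w.IsCycle ∧ Odd w.length), (w.length : ℕ∞)

/-- `c` is a `(p, q)`-coloring of `G`: a coloring by `{0, …, p - 1}` such that
`q ≤ |c x - c y| ≤ p - q` for adjacent vertices `x`, `y` (inequalities between integers). -/
def IsCircularColoring {V : Type u} (G : SimpleGraph V) (p q : ℕ) (c : V → Fin p) : Prop :=
  ∀ x y : V, G.Adj x y →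
    (q : ℤ) ≤ |((c x : ℕ) : ℤ) - ((c y : ℕ) : ℤ)| ∧
      |((c x : ℕ) : ℤ) - ((c y : ℕ) : ℤ)| ≤ (p : ℤ) - (q : ℤ)

/-- `G` has a `(p, q)`-coloring. -/
def CircularColorable {V : Type u} (G : SimpleGraph V) (p q : ℕ) : Prop :=
  ∃ c : V → Fin p, G.IsCircularColoring p q c

/-- The circular chromatic number of a finite graph `G`: the infimum of the ratios `p / q`, over
integers `1 ≤ q ≤ p`, such that `G` has a `(p, q)`-coloring. (The set of these ratios is nonempty
for every finite graph. The condition `q ≤ p` is automatic if `G` has an edge; without it,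
edgeless graphs would have the value `0` instead of the usual `1`.) -/
noncomputable def circularChromaticNumber {V : Type u} (G : SimpleGraph V) : ℝ :=
  sInf {r : ℝ | ∃ p q : ℕ, 1 ≤ q ∧ q ≤ p ∧ G.CircularColorable p q ∧ r = (p : ℝ) / (q : ℝ)}

end SimpleGraph

/-! Large odd-girth makes every ball of moderate radius bipartite, so the task is to glue local
2-colorings. The gluing rests on asymptotic dimension at most one: for each `ℓ` there is a bound
`D`, depending only on `ℓ` and the decomposition parameters, and a `Bool`-coloring whose
monochromatic chains of `ℓ`-jumps have endpoints within `D` (`TreeDec.exists_isClusterColoring`).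

Given such a coloring, each cluster gets a root, and parity of the distance to the root properly
2-colors the cluster and its surroundings. Where a `false` cluster disagrees with the parity of a
nearby `true` cluster, the conflict is absorbed by one turn around an odd cycle of length `2 * q +
1` (`circularColorable_of_isClusterColoring`).

The cluster coloring is built by induction on the adhesion of a tree decomposition. Nodes are
grouped into blocks so that inside a block every lower adhesion set has a vertex near the top one,
while adhesion sets of consecutive blocks are far apart. Deleting the neighborhood of the top
adhesion set lowers the adhesion within the block. What hangs below the block is replaced by
distance profiles, boundedly many per bag, so the induction applies to the resulting graph
(`TreeDec.exists_treeDec_profileGraph`). The block colorings are then glued, a ring of opposite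
color separating each block from the part it hands to its parent. -/

namespace SimpleGraph

variable {V : Type u} {G : SimpleGraph V}

/-! ### Odd closed walks, and parity of distances in balls. -/

/-- If the new first vertex already lies on the path, the initial piece up to it either has even
length and closes to an odd cycle, or has odd length and is cut off together with the new edge,
keeping the parity. -/
theorem Walk.exists_odd_cycle_or_exists_path {u v : V} (p : G.Walk u v) :
    (∃ (a : V) (w : G.Walk a a), w.IsCycle ∧ Odd w.length ∧ w.length ≤ p.length) ∨
      ∃ r : G.Walk u v, r.IsPath ∧ r.length ≤ p.length ∧ r.length % 2 = p.length % 2 := by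
  classical
  induction p with
  | nil => exact Or.inr ⟨.nil, by simp, le_rfl, rfl⟩
  | @cons u v' v h p ih =>
    rcases ih with ⟨a, w, hw, ho, hl⟩ | ⟨r, hr, hl, hm⟩
    · exact Or.inl ⟨a, w, hw, ho, by simp only [Walk.length_cons]; omega⟩
    by_cases hu : u ∈ r.support
    · have hsum : (r.takeUntil u hu).length + (r.dropUntil u hu).length = r.length := by
        rw [← Walk.length_append, Walk.take_spec]
      rcases Nat.even_or_odd (r.takeUntil u hu).length with he | ho
      · left
        refine ⟨u, .cons h (r.takeUntil u hu), ?_, ?_, ?_⟩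
        · rw [Walk.cons_isCycle_iff]
          refine ⟨hr.takeUntil hu, fun hmem => ?_⟩
          have hP := hr.takeUntil hu
          generalize r.takeUntil u hu = s at hP hmem he
          cases s with
          | nil => simp at hmem
          | @cons _ b _ h' s' =>
            rw [Walk.cons_isPath_iff] at hP
            rw [Walk.edges_cons, List.mem_cons] at hmem
            rcases hmem with hmem | hmem
            · have hb : b = u := by
                rcases Sym2.eq_iff.1 hmem with ⟨h1, -⟩ | ⟨h1, -⟩
                · exact absurd h1 h.ne
                · exact h1.symm
              subst hb
              have := (Walk.isPath_iff_nil.1 hP.1).eq_nil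
              subst this
              simp at he
            · exact hP.2 (Walk.snd_mem_support_of_mem_edges _ hmem)
        · rw [Walk.length_cons]; exact he.add_one
        · simp only [Walk.length_cons]; omega
      · right
        refine ⟨r.dropUntil u hu, hr.dropUntil hu, ?_, ?_⟩
        · simp only [Walk.length_cons]; omega
        · obtain ⟨m, hm'⟩ := ho
          simp only [Walk.length_cons]; omega
    · exact Or.inr ⟨.cons h r, hr.cons hu, by simp only [Walk.length_cons]; omega,
        by simp only [Walk.length_cons]; omega⟩

theorem Walk.exists_odd_cycle {u : V} (p : G.Walk u u) (hp : Odd p.length) :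
    ∃ (a : V) (w : G.Walk a a), w.IsCycle ∧ Odd w.length ∧ w.length ≤ p.length := by
  rcases p.exists_odd_cycle_or_exists_path with h | ⟨r, hr, -, hm⟩
  · exact h
  · have := (Walk.isPath_iff_nil.1 hr).eq_nil
    subst this
    obtain ⟨m, hm'⟩ := hp
    simp only [Walk.length_nil] at hm
    omega

theorem le_length_of_le_oddGirth {g : ℕ} (hg : (g : ℕ∞) ≤ G.oddGirth) {u : V} (p : G.Walk u u)
    (hp : Odd p.length) : g ≤ p.length := by
  obtain ⟨a, w, hw, ho, hl⟩ := p.exists_odd_cycle hp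
  refine le_trans ?_ hl
  have : G.oddGirth ≤ (w.length : ℕ∞) := iInf_le_of_le a (iInf_le_of_le w (iInf_le _ ⟨hw, ho⟩))
  exact_mod_cast hg.trans this

theorem le_oddGirth_of_hom {W : Type v} {H : SimpleGraph W} (f : G →g H) {g : ℕ}
    (hg : (g : ℕ∞) ≤ H.egirth) : (g : ℕ∞) ≤ G.oddGirth := by
  refine le_iInf fun a => le_iInf fun w => le_iInf fun hw => ?_
  obtain ⟨b, w', hw', -, hl⟩ := (w.map f).exists_odd_cycle (by simpa using hw.2)
  rw [Walk.length_map] at hl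
  exact (hg.trans (egirth_le_length hw')).trans (by exact_mod_cast hl)

/-- Otherwise two shortest walks and the edge would form an odd closed walk of length at most `2 * m
+ 1`. Thus distance parity properly 2-colors the ball of radius `m`. -/
theorem dist_mod_two_ne {m : ℕ} (hg : ((2 * m + 2 : ℕ) : ℕ∞) ≤ G.oddGirth) {x u v : V}
    (hu : G.edist x u ≤ m) (hv : G.edist x v ≤ m) (h : G.Adj u v) :
    G.dist x u % 2 ≠ G.dist x v % 2 := by
  intro he
  have hru : G.Reachable x u := reachable_of_edist_ne_top (hu.trans_lt (ENat.natCast_lt_top m)).ne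
  have hrv : G.Reachable x v := reachable_of_edist_ne_top (hv.trans_lt (ENat.natCast_lt_top m)).ne
  rw [← hru.coe_dist_eq_edist] at hu
  rw [← hrv.coe_dist_eq_edist] at hv
  norm_cast at hu hv
  obtain ⟨p, hp⟩ := hru.exists_walk_length_eq_dist
  obtain ⟨r, hr⟩ := hrv.exists_walk_length_eq_dist
  have := le_length_of_le_oddGirth hg (p.append (.cons h r.reverse)) (by
    simp only [Walk.length_append, Walk.length_cons, Walk.length_reverse, hp, hr]
    rw [Nat.odd_iff]; omega)
  simp only [Walk.length_append, Walk.length_cons, Walk.length_reverse, hp, hr] at this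
  omega

theorem edist_le_add {u v w : V} {a b m : ℕ} (h₁ : G.edist u v ≤ a) (h₂ : G.edist v w ≤ b)
    (hm : a + b ≤ m) : G.edist u w ≤ m :=
  G.edist_triangle.trans ((add_le_add h₁ h₂).trans (by exact_mod_cast hm))

theorem Adj.edist_le_one {u v : V} (h : G.Adj u v) : G.edist u v ≤ (1 : ℕ) := by
  rw [edist_eq_one_iff_adj.2 h]; simp

theorem reflTransGen_symm {α : Type*} {r : α → α → Prop} (hr : ∀ x y, r x y → r y x) {x y : α}
    (h : Relation.ReflTransGen r x y) : Relation.ReflTransGen r y x := by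
  induction h with
  | refl => exact .refl
  | tail _ h ih => exact .head (hr _ _ h) ih

/-! ### From a cluster coloring to a homomorphism to an odd cycle. -/

/-- Any two vertices joined by a monochromatic chain of `ℓ`-jumps are at distance at most `D`. -/
def IsClusterColoring (G : SimpleGraph V) (ℓ D : ℕ) (c : V → Bool) : Prop :=
  ∀ u v, Relation.ReflTransGen (fun x y => c x = c y ∧ G.edist x y ≤ ℓ) u v → G.edist u v ≤ D

theorem exists_truncated_distance (G : SimpleGraph V) (S : Set V) (n : ℕ) :
    ∃ t : V → ℕ, (∀ v ∈ S, t v = 0) ∧ (∀ u v, G.Adj u v → t v ≤ t u + 1) ∧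
      ∀ v, t v < n → ∃ a ∈ S, G.edist v a ≤ t v := by
  let T : V → Set ℕ := fun v => {m | m = n ∨ ∃ a ∈ S, G.edist v a ≤ m}
  have hT : ∀ v, sInf (T v) = n ∨ ∃ a ∈ S, G.edist v a ≤ (sInf (T v) : ℕ) := fun v =>
    Nat.sInf_mem (s := T v) ⟨n, Or.inl rfl⟩
  refine ⟨fun v => sInf (T v), ?_, ?_, ?_⟩
  · intro v hv
    exact Nat.le_zero.1 (Nat.sInf_le (Or.inr ⟨v, hv, by simp⟩))
  · intro u v h
    change sInf (T v) ≤ sInf (T u) + 1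
    rcases hT u with hu | ⟨a, ha, hu⟩
    · exact (Nat.sInf_le (Or.inl rfl : n ∈ T v)).trans (by omega)
    · exact Nat.sInf_le (Or.inr ⟨a, ha, edist_le_add h.symm.edist_le_one hu (by omega)⟩)
  · intro v hv
    rcases hT v with h | h
    · exact absurd h hv.ne
    · exact h

/-- Multiplication by `q` turns consecutive residues modulo `2 * q + 1` into residues differing by
`q` or `q + 1`; both are allowed because `p ≥ 2 * q + 1`. -/
theorem circularColorable_of_cyclic_walk {p q : ℕ} (hp : 2 * q < p) (f : V → ℕ)
    (hf : ∀ u v, G.Adj u v →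
      f u ≡ f v + 1 [MOD 2 * q + 1] ∨ f v ≡ f u + 1 [MOD 2 * q + 1]) :
    G.CircularColorable p q := by
  have key : ∀ a b : ℕ, b ≡ a + 1 [MOD 2 * q + 1] →
      (q * b) % (2 * q + 1) = q * a % (2 * q + 1) + q ∨
        (q * b) % (2 * q + 1) + q + 1 = q * a % (2 * q + 1) := by
    intro a b h
    have h1 : (q * b) % (2 * q + 1) = (q * a % (2 * q + 1) + q) % (2 * q + 1) := by
      have := h.mul_left q
      rw [mul_add, mul_one] at this
      rw [this, Nat.mod_add_mod]
    have h2 : q * a % (2 * q + 1) < 2 * q + 1 := Nat.mod_lt _ (by omega)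
    rw [h1]
    generalize q * a % (2 * q + 1) = x at h2
    by_cases hx : x + q < 2 * q + 1
    · left; exact Nat.mod_eq_of_lt hx
    · right
      rw [Nat.mod_eq_sub_mod (by omega), Nat.mod_eq_of_lt (by omega)]
      omega
  refine ⟨fun v => ⟨q * f v % (2 * q + 1), lt_of_lt_of_le (Nat.mod_lt _ (by omega)) hp⟩, ?_⟩
  intro u v h
  simp only [abs_le, le_abs]
  rcases hf u v h with h | h
  · rcases key _ _ h with h | h <;> omega
  · rcases key _ _ h with h | h <;> omega

theorem circularColorable_of_isClusterColoring {p q D : ℕ} (hp : 2 * q < p) {c : V → Bool}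
    (hc : G.IsClusterColoring (2 * (2 * q + 1) + 1) D c)
    (hg : ((2 * (D + (2 * q + 1)) + 2 : ℕ) : ℕ∞) ≤ G.oddGirth) : G.CircularColorable p q := by
  classical
  obtain ⟨n, hn⟩ : ∃ n, n = 2 * q + 1 := ⟨_, rfl⟩
  rw [← hn] at hc hg
  let r : V → V → Prop := Relation.ReflTransGen
    (fun x y => c x = c y ∧ G.edist x y ≤ (2 * n + 1 : ℕ))
  have hsymm : ∀ {x y}, r x y → r y x := by
    intro x y h
    refine reflTransGen_symm (fun x y hxy => ?_) h
    exact ⟨hxy.1.symm, by rw [edist_comm]; exact hxy.2⟩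
  let S : Setoid V := ⟨r, fun _ => .refl, hsymm, fun h h' => h.trans h'⟩
  let root : V → V := fun v => (Quotient.mk S v).out
  have hroot : ∀ v, G.edist (root v) v ≤ D := fun v => hc _ _ (Quotient.exact (Quotient.out_eq (Quotient.mk S v)))
  have hroot_eq : ∀ u v, c u = c v → G.edist u v ≤ (2 * n + 1 : ℕ) → root u = root v := by
    intro u v h1 h2
    have : Quotient.mk S u = Quotient.mk S v := Quotient.sound (.single ⟨h1, h2⟩)
    simp only [root, this]
  obtain ⟨t, ht0, ht1, ht⟩ := G.exists_truncated_distance {v | c v = true} n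
  choose! α hα hαd using ht
  let σ : V → V → ℕ := fun x v => G.dist x v % 2
  have hσ : ∀ x u v, G.Adj u v → G.edist x u ≤ (D + n : ℕ) → G.edist x v ≤ (D + n : ℕ) →
      σ x u + σ x v = 1 := by
    intro x u v h hu hv
    have := dist_mod_two_ne hg hu hv h
    simp only [σ]; omega
  have hσ2 : ∀ x u, σ x u < 2 := fun x u => Nat.mod_lt _ (by omega)
  have hown : ∀ v, G.edist (root v) v ≤ (D + n : ℕ) := fun v =>
    (hroot v).trans (by exact_mod_cast Nat.le_add_right _ _)
  have hnear : ∀ v, t v < n → G.edist (root (α v)) v ≤ (D + n : ℕ) := by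
    intro v hv
    refine edist_le_add (hroot (α v)) (b := t v) ?_ (by omega)
    rw [edist_comm]; exact hαd v hv
  -- `s` is the progress of the turn: where the parities of the own root and of the root of the
  -- nearest `true` vertex disagree, it grows from `0` at distance `n` to `n - 1` at distance `1`.
  let s : V → ℕ := fun v => if t v < n ∧ σ (root (α v)) v ≠ σ (root v) v then n - t v else 0
  -- `f v` is whichever of `s v`, `s v + 1` has the parity of `v` in its own cluster; hence if the
  -- parities differ and `s` changes by at most one, `f` changes by exactly one.
  let f : V → ℕ := fun v => s v + (s v + σ (root v) v) % 2
  refine circularColorable_of_cyclic_walk hp f ?_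
  rw [← hn]
  have hstep : ∀ u v, σ (root u) u + σ (root v) v = 1 → s u ≤ s v + 1 → s v ≤ s u + 1 →
      f u ≡ f v + 1 [MOD n] ∨ f v ≡ f u + 1 [MOD n] := by
    intro u v h1 h2 h3
    have : f u = f v + 1 ∨ f v = f u + 1 := by
      simp only [f]; omega
    rcases this with h | h <;> rw [h]
    · exact Or.inl rfl
    · exact Or.inr rfl
  have hsame : ∀ u v, G.Adj u v → c u = c v →
      f u ≡ f v + 1 [MOD n] ∨ f v ≡ f u + 1 [MOD n] := by
    intro u v h hcuv
    have hr : root u = root v := hroot_eq u v hcuv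
      (h.edist_le_one.trans (by exact_mod_cast Nat.le_add_left _ _))
    have h1 : σ (root u) u + σ (root v) v = 1 := by
      have := hσ (root u) u v h (hown u) (hr ▸ hown v)
      rwa [← hr]
    have h2 := ht1 u v h
    have h3 := ht1 v u h.symm
    refine hstep u v h1 ?_ ?_
    all_goals
      simp only [s]
      by_cases hu : t u < n
      · by_cases hv : t v < n
        · have hαuv : root (α u) = root (α v) := by
            refine hroot_eq _ _ ((hα u hu).trans (hα v hv).symm) ?_
            refine edist_le_add (a := t u) (b := t v + 1) (v := u) ?_ ?_ (by omega)
            · rw [edist_comm]; exact hαd u hu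
            · exact edist_le_add h.edist_le_one (hαd v hv) (by omega)
          have h4 := hσ _ u v h (hnear u hu) (hαuv ▸ hnear v hv)
          have h5 := hσ2 (root u) u
          rw [← hαuv]
          split_ifs <;> omega
        · simp only [hu, hv, true_and, false_and, if_false]
          split_ifs <;> omega
      · by_cases hv : t v < n
        · simp only [hu, hv, true_and, false_and, if_false]
          split_ifs <;> omega
        · simp only [hu, hv, false_and, if_false]
          omega
  have hdiff : ∀ u v, G.Adj u v → c u = true → c v = false →
      f u ≡ f v + 1 [MOD n] ∨ f v ≡ f u + 1 [MOD n] := by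
    intro u v h hu hv
    have htu : t u = 0 := ht0 u hu
    have htv : t v ≤ 1 := by have := ht1 u v h; omega
    by_cases hv0 : t v = 0
    · have h1 := hα v (by omega)
      have h2 := hαd v (by omega)
      rw [hv0] at h2
      have h3 : v = α v := by simpa using h2
      rw [← h3] at h1
      simp only [Set.mem_ofPred_eq] at h1
      rw [hv] at h1
      exact absurd h1 (by simp)
    have htv1 : t v = 1 := by omega
    have hαu : α u = u := by
      have h2 := hαd u (by omega)
      rw [htu] at h2
      have h3 : u = α u := by simpa using h2
      exact h3.symm
    have hsu : s u = 0 := by simp [s, hαu]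
    -- For `n = 1` the vertex `v` is beyond the truncation and `α v` carries no information, but
    -- every congruence holds.
    by_cases hn1 : n = 1
    · subst hn1
      exact Or.inl (by simp [Nat.modEq_one])
    have hvn : t v < n := by omega
    have hαv : root (α v) = root u := by
      refine hroot_eq _ _ ((hα v hvn).trans hu.symm) ?_
      refine edist_le_add (a := t v) (b := 1) (v := v) ?_ h.symm.edist_le_one (by omega)
      rw [edist_comm]; exact hαd v hvn
    have h4 := hσ _ u v h (hown u) (hαv ▸ hnear v hvn)
    have h5 := hσ2 (root v) v
    by_cases hs : σ (root u) v = σ (root v) v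
    · have hsv : s v = 0 := by simp [s, hαv, hs]
      exact hstep u v (by omega) (by omega) (by omega)
    -- Since `n` is odd, `n - 1` is even: the full turn changes the parity and is invisible modulo
    -- `n`.
    · have hsv : s v = n - 1 := by simp [s, hαv, hs, htv1]; omega
      have hfu : f u = σ (root u) u := by simp only [f, hsu]; omega
      have hfv : f v = n - 1 + σ (root u) u := by simp only [f, hsv]; omega
      left
      rw [hfu, hfv]
      have : n - 1 + σ (root u) u + 1 = σ (root u) u + n := by omega
      rw [this]
      exact (Nat.add_modEq_right).symm
  intro u v h
  rcases hcu : c u with _ | _ <;> rcases hcv : c v with _ | _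
  · exact hsame u v h (hcu.trans hcv.symm)
  · exact (hdiff v u h.symm hcv hcu).symm
  · exact hdiff u v h hcu hcv
  · exact hsame u v h (hcu.trans hcv.symm)

/-! ### Rooted tree decompositions of graphs of bounded tree-width. -/

/-- A rooted tree decomposition of `G`, recorded by the topmost node `top v` containing each vertex,
the parent function `par`, and the adhesion `A i` of each node to its parent: the bag of `i` is
`A i ∪ top⁻¹ {i}`. Adhesions have at most `a` vertices, and each bag introduces at most `w`. -/
structure TreeDec (G : SimpleGraph V) (a w : ℕ) (I : Type u) where
  top : V → I
  par : I → I
  dep : I → ℕ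
  A : I → Finset V
  mem_par : ∀ i v, v ∈ A i → v ∈ A (par i) ∨ top v = par i
  dep_lt : ∀ i, (A i).Nonempty → dep (par i) < dep i
  card_le : ∀ i, (A i).card ≤ a
  fiber : ∀ i, ∃ s : Finset V, (∀ v, top v = i → v ∈ s) ∧ s.card ≤ w
  adj : ∀ u v, G.Adj u v → top u = top v ∨ u ∈ A (top v) ∨ v ∈ A (top u)

/-- Enlarging the bounds, and pulling back along an injective homomorphism. -/
noncomputable def TreeDec.comap {W : Type u} {H : SimpleGraph W} {a w b x : ℕ} {I : Type u}
    (d : TreeDec H a w I) (f : G →g H) (hf : Function.Injective f) (ha : a ≤ b) (hw : w ≤ x) :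
    TreeDec G b x I where
  top v := d.top (f v)
  par := d.par
  dep := d.dep
  A i := (d.A i).preimage f hf.injOn
  mem_par i v h := by
    simp only [Finset.mem_preimage] at h ⊢
    exact d.mem_par i _ h
  dep_lt i h := by
    obtain ⟨v, hv⟩ := h
    exact d.dep_lt i ⟨f v, by simpa using hv⟩
  card_le i := by
    classical
    refine le_trans ?_ ((d.card_le i).trans ha)
    rw [← Finset.card_image_of_injective _ hf]
    exact Finset.card_le_card (by intro y; simp only [Finset.mem_image, Finset.mem_preimage]; grind)
  fiber i := by
    classical
    obtain ⟨s, hs, hc⟩ := d.fiber i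
    refine ⟨s.preimage f hf.injOn, fun v hv => by simpa using hs _ hv, le_trans ?_ (hc.trans hw)⟩
    rw [← Finset.card_image_of_injective _ hf]
    exact Finset.card_le_card (by intro y; simp only [Finset.mem_image, Finset.mem_preimage]; grind)
  adj u v h := by
    simp only [Finset.mem_preimage]
    exact d.adj _ _ (f.map_adj h)

theorem IsKTree.finite {k : ℕ} {T : SimpleGraph V} (hT : IsKTree k T) : Finite V := by
  induction hT with
  | complete hcard => exact Nat.finite_of_card_ne_zero (by omega)
  | add G v _ _ _ ih =>
    have := (Set.toFinite ({v}ᶜ : Set _)).union (Set.finite_singleton v)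
    rw [Set.compl_union_self] at this
    exact Set.finite_univ_iff.1 this

/-- Each added vertex becomes a new node whose adhesion is its neighborhood. The clause on cliques
is the induction invariant: it provides the parent of that node. -/
theorem IsKTree.exists_treeDec {k : ℕ} {T : SimpleGraph V} (hT : IsKTree k T) :
    ∃ (I : Type u) (d : TreeDec T k (k + 1) I),
      ∀ S : Set V, T.IsClique S → ∃ i, ∀ y ∈ S, y ∈ d.A i ∨ d.top y = i := by
  classical
  have hfin := hT.finite
  induction hT with
  | @complete V hcard =>
    have := Fintype.ofFinite V
    refine ⟨PUnit, ⟨fun _ => ⟨⟩, fun _ => ⟨⟩, fun _ => 0, fun _ => ∅, by simp, by simp, by simp,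
      fun _ => ⟨Finset.univ, by simp, ?_⟩, by simp⟩, fun S _ => ⟨⟨⟩, by simp⟩⟩
    rw [Finset.card_univ, ← Nat.card_eq_fintype_card, hcard]
  | @add V G v hG hdeg hclique ih =>
    obtain ⟨I, d, hd⟩ := ih inferInstance
    have hNfin : (G.neighborSet v).Finite := Set.toFinite _
    have hclq : ∀ S : Set V, G.IsClique S →
        (G.induce ({v}ᶜ : Set V)).IsClique (Subtype.val ⁻¹' S) := by
      intro S hS x hx y hy hxy
      exact hS hx hy (fun h => hxy (Subtype.ext h))
    obtain ⟨i₀, hi₀⟩ := hd _ (hclq _ hclique)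
    let top : V → Option I := fun x => if h : x = v then none else some (d.top ⟨x, h⟩)
    have top_v : top v = none := by simp [top]
    have top_ne : ∀ x (h : x ≠ v), top x = some (d.top ⟨x, h⟩) := fun x h => by simp [top, h]
    let A : Option I → Finset V := fun o => o.elim hNfin.toFinset
      (fun i => (d.A i).map (Function.Embedding.subtype _))
    have mem_none : ∀ x, x ∈ A none ↔ G.Adj v x := fun x => by simp [A]
    have mem_some : ∀ i x, x ∈ A (some i) ↔ ∃ h : x ≠ v, (⟨x, h⟩ : ({v}ᶜ : Set V)) ∈ d.A i :=
      fun i x => by simp [A]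
    refine ⟨Option I, ⟨top, fun o => o.elim (some i₀) (fun i => some (d.par i)),
      fun o => o.elim (d.dep i₀ + 1) d.dep, A, ?_, ?_, ?_, ?_, ?_⟩, ?_⟩
    · rintro (_ | i) x hx
      · rw [mem_none] at hx
        simp only [Option.elim_none, mem_some, top_ne x hx.ne', Option.some.injEq]
        rcases hi₀ ⟨x, hx.ne'⟩ hx with h | h
        · exact Or.inl ⟨_, h⟩
        · exact Or.inr h
      · rw [mem_some] at hx
        obtain ⟨hxv, hx⟩ := hx
        simp only [Option.elim_some, mem_some, top_ne x hxv, Option.some.injEq]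
        rcases d.mem_par i _ hx with h | h
        · exact Or.inl ⟨_, h⟩
        · exact Or.inr h
    · rintro (_ | i) ⟨x, hx⟩
      · simp
      · rw [mem_some] at hx
        exact d.dep_lt i ⟨_, hx.2⟩
    · rintro (_ | i)
      · rw [← hdeg, Set.ncard_eq_toFinset_card _ hNfin]; exact le_rfl
      · simpa [A] using d.card_le i
    · rintro (_ | i)
      · refine ⟨{v}, fun x hx => ?_, by simp⟩
        by_contra hne
        rw [Finset.mem_singleton] at hne
        simp [top_ne x hne] at hx
      · obtain ⟨s, hs, hc⟩ := d.fiber i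
        refine ⟨s.map (Function.Embedding.subtype _), fun x hx => ?_, by simpa using hc⟩
        by_cases hxv : x = v
        · subst hxv; simp [top_v] at hx
        · rw [top_ne x hxv, Option.some.injEq] at hx
          rw [Finset.mem_map]
          exact ⟨_, hs _ hx, rfl⟩
    · intro x y hxy
      by_cases hx : x = v
      · subst hx
        rw [top_v, mem_none]
        exact Or.inr (Or.inr hxy)
      by_cases hy : y = v
      · subst hy
        rw [top_v, mem_none]
        exact Or.inr (Or.inl hxy.symm)
      rw [top_ne x hx, top_ne y hy, mem_some, mem_some, Option.some.injEq]
      rcases d.adj ⟨x, hx⟩ ⟨y, hy⟩ hxy with h | h | h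
      · exact Or.inl h
      · exact Or.inr (Or.inl ⟨_, h⟩)
      · exact Or.inr (Or.inr ⟨_, h⟩)
    · intro S hS
      by_cases hv : v ∈ S
      · refine ⟨none, fun y hy => ?_⟩
        by_cases hyv : y = v
        · subst hyv; exact Or.inr top_v
        · exact Or.inl ((mem_none y).2 (hS hv hy (Ne.symm hyv)))
      · obtain ⟨i, hi⟩ := hd _ (hclq S hS)
        refine ⟨some i, fun y hy => ?_⟩
        have hyv : y ≠ v := fun h => hv (h ▸ hy)
        change y ∈ A (some i) ∨ top y = some i
        rw [mem_some, top_ne y hyv, Option.some.injEq]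
        rcases hi ⟨y, hyv⟩ hy with h | h
        · exact Or.inl ⟨_, h⟩
        · exact Or.inr h

theorem exists_treeDec_of_treeWidth_le {k : ℕ} (h : G.treeWidth ≤ k) :
    ∃ I : Type u, Nonempty (TreeDec G k (k + 1) I) := by
  obtain ⟨j, hj, hjk⟩ : ∃ j, G.IsPartialKTree j ∧ j ≤ k := by
    by_contra! hcon
    have : ((k + 1 : ℕ) : ℕ∞) ≤ G.treeWidth :=
      le_iInf fun j => le_iInf fun hj => by exact_mod_cast hcon j hj
    have := this.trans h
    norm_cast at this
    omega
  obtain ⟨W, T, hT, ⟨f, hf⟩⟩ := hj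
  obtain ⟨I, d, -⟩ := hT.exists_treeDec
  exact ⟨I, ⟨d.comap f hf hjk (by omega)⟩⟩

/-! ### Chains of jumps, removal of balls, and gaps between distance scales. -/

/-- Chains of `ℓ`-jumps inside `S` have endpoints at distance at most `D`. -/
def IsBoundedOn (G : SimpleGraph V) (ℓ D : ℕ) (S : Set V) : Prop :=
  ∀ u v, Relation.ReflTransGen (fun x y => x ∈ S ∧ y ∈ S ∧ G.edist x y ≤ ℓ) u v → G.edist u v ≤ D

/-- A chain either avoids the ball or, followed from either end until it first meets the ball, shows
that this end is within `D + ℓ + R` of `x`. -/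
theorem IsBoundedOn.of_diff_ball {ℓ D R : ℕ} {S : Set V} {x : V}
    (h : G.IsBoundedOn ℓ D {v | v ∈ S ∧ ¬ G.edist x v ≤ R}) :
    G.IsBoundedOn ℓ (2 * (D + ℓ + R)) S := by
  have key : ∀ u v, Relation.ReflTransGen (fun x y => x ∈ S ∧ y ∈ S ∧ G.edist x y ≤ ℓ) u v →
      G.edist u v ≤ D ∨ G.edist u x ≤ (D + ℓ + R : ℕ) := by
    intro u v huv
    have : Relation.ReflTransGen (fun y z => y ∈ {v | v ∈ S ∧ ¬ G.edist x v ≤ R} ∧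
        z ∈ {v | v ∈ S ∧ ¬ G.edist x v ≤ R} ∧ G.edist y z ≤ ℓ) u v ∨
        G.edist u x ≤ (D + ℓ + R : ℕ) := by
      induction huv with
      | refl => exact Or.inl .refl
      | @tail y z _ hyz ih =>
        rcases ih with ih | ih
        · have huy := h _ _ ih
          by_cases hz : G.edist x z ≤ R
          · right
            rw [edist_comm] at hz
            exact edist_le_add (edist_le_add huy hyz.2.2 le_rfl) hz le_rfl
          by_cases hy : G.edist x y ≤ R
          · right
            rw [edist_comm] at hy
            exact edist_le_add huy hy (by omega)
          · exact Or.inl (ih.tail ⟨⟨hyz.1, hy⟩, ⟨hyz.2.1, hz⟩, hyz.2.2⟩)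
        · exact Or.inr ih
    exact this.imp_left (h _ _)
  intro u v huv
  have hvu := reflTransGen_symm (fun y z hyz => by
    exact ⟨hyz.2.1, hyz.1, by rw [edist_comm]; exact hyz.2.2⟩) huv
  rcases key u v huv with h1 | h1
  · exact h1.trans (by norm_cast; omega)
  rcases key v u hvu with h2 | h2
  · rw [edist_comm]; exact h2.trans (by norm_cast; omega)
  · rw [G.edist_comm (u := v)] at h2
    exact edist_le_add h1 h2 (by omega)

theorem IsBoundedOn.mono {ℓ D E : ℕ} {S : Set V} (h : G.IsBoundedOn ℓ D S) (hDE : D ≤ E) :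
    G.IsBoundedOn ℓ E S := fun u v huv => (h u v huv).trans (by exact_mod_cast hDE)

theorem IsBoundedOn.of_diff_balls {ℓ D R a : ℕ} {S : Set V} (X : Finset V) (hX : X.card ≤ a)
    (h : G.IsBoundedOn ℓ D {v | v ∈ S ∧ ∀ x ∈ X, ¬ G.edist x v ≤ R}) :
    G.IsBoundedOn ℓ ((fun D => 2 * (D + ℓ + R))^[a] D) S := by
  classical
  induction X using Finset.induction generalizing a D with
  | empty =>
    have hD : D ≤ (fun D => 2 * (D + ℓ + R))^[a] D :=
      Function.id_le_iterate_of_id_le (fun n => by simp only [id]; omega) a D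
    simp only [Finset.notMem_empty, false_imp_iff, implies_true, and_true] at h
    exact IsBoundedOn.mono h hD
  | insert x X hx ih =>
    rw [Finset.card_insert_of_notMem hx] at hX
    obtain ⟨a, rfl⟩ : ∃ m, a = m + 1 := ⟨a - 1, by omega⟩
    rw [Function.iterate_succ_apply]
    refine ih (by omega) (IsBoundedOn.of_diff_ball (x := x) ?_)
    have : {v | v ∈ S ∧ ∀ y ∈ insert x X, ¬ G.edist y v ≤ R} =
        {v | v ∈ {v | v ∈ S ∧ ∀ y ∈ X, ¬ G.edist y v ≤ R} ∧ ¬ G.edist x v ≤ R} := by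
      ext v
      simp only [Finset.mem_insert, Set.mem_ofPred_eq]
      grind
    rwa [← this]

theorem edist_le_succ {u w : V} {n : ℕ} (h : G.edist u w ≤ (n + 1 : ℕ)) :
    G.edist u w ≤ n ∨ ∃ w', G.edist u w' ≤ n ∧ G.Adj w' w := by
  obtain ⟨p, hp⟩ := exists_walk_of_edist_ne_top (h.trans_lt (ENat.natCast_lt_top _)).ne
  rw [← hp] at h
  norm_cast at h
  by_cases hn : p.length ≤ n
  · exact Or.inl ((edist_le p).trans (by exact_mod_cast hn))
  right
  cases hr : p.reverse with
  | nil =>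
    have : p.length = 0 := by rw [← Walk.length_reverse, hr]; rfl
    omega
  | @cons _ w' _ hadj q =>
    have : p.length = q.length + 1 := by rw [← Walk.length_reverse, hr]; rfl
    refine ⟨w', (edist_le q.reverse).trans ?_, hadj.symm⟩
    rw [Walk.length_reverse]
    exact_mod_cast (by omega : q.length ≤ n)

/-- Pigeonhole: a failure at scale `ℓ * 16 ^ j` gives a pair with distance between this scale and
the next. There are `a * a + 1` scales and at most `a * a` pairs. -/
theorem exists_distance_gap (G : SimpleGraph V) (ℓ : ℕ) {a : ℕ} (X : Finset V)
    (hX : X.card ≤ a) :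
    ∃ r, ℓ ≤ r ∧ r ≤ ℓ * 16 ^ (a * a) ∧
      ∀ x ∈ X, ∀ y ∈ X, G.edist x y ≤ (16 * r : ℕ) → G.edist x y ≤ r := by
  classical
  by_contra! hcon
  have : ∀ j : ℕ, ∃ z : V × V, j ≤ a * a → z ∈ X ×ˢ X ∧
      G.edist z.1 z.2 ≤ (ℓ * 16 ^ (j + 1) : ℕ) ∧ ((ℓ * 16 ^ j : ℕ) : ℕ∞) < G.edist z.1 z.2 := by
    intro j
    by_cases hj : j ≤ a * a
    · obtain ⟨x, hx, y, hy, h1, h2⟩ := hcon (ℓ * 16 ^ j) (Nat.le_mul_of_pos_right _ (by positivity))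
        (Nat.mul_le_mul_left _ (Nat.pow_le_pow_right (by norm_num) hj))
      refine ⟨(x, y), fun _ => ⟨by simp [hx, hy], h1.trans (le_of_eq ?_), h2⟩⟩
      congr 1
      ring
    · have hne : X.Nonempty := by
        obtain ⟨x, hx, -⟩ := hcon ℓ le_rfl (Nat.le_mul_of_pos_right _ (by positivity))
        exact ⟨x, hx⟩
      exact ⟨(hne.choose, hne.choose), fun h => absurd h hj⟩
  choose z hz using this
  obtain ⟨i, hi, j, hj, hij, he⟩ := Finset.exists_ne_map_eq_of_card_lt_of_maps_to
    (s := Finset.range (a * a + 1)) (t := X ×ˢ X) (f := z) (by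
      rw [Finset.card_range, Finset.card_product]
      exact Nat.lt_succ_of_le (Nat.mul_le_mul hX hX))
    (by
      intro j hj
      exact (hz j (by simpa [Nat.lt_succ_iff] using hj)).1)
  have main : ∀ i j, i ≤ a * a → j ≤ a * a → i < j → z i ≠ z j := by
    intro i j hi hj hij he
    have h1 := (hz i hi).2.1
    have h2 := (hz j hj).2.2
    rw [he] at h1
    have h3 := h2.trans_le h1
    norm_cast at h3
    have : ℓ * 16 ^ (i + 1) ≤ ℓ * 16 ^ j :=
      Nat.mul_le_mul_left _ (Nat.pow_le_pow_right (by norm_num) hij)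
    omega
  rw [Finset.mem_range, Nat.lt_succ_iff] at hi hj
  rcases lt_or_gt_of_ne hij with h | h
  · exact main i j hi hj h he
  · exact main j i hj hi h he.symm

/-! ### Block decompositions. -/

/-- A decomposition into blocks: `pb i` is the parent of the block `i`, and `X i` its adhesion
set. Consecutive adhesion sets are at distance more than `F`. -/
structure BlockDec (G : SimpleGraph V) (a F : ℕ) (I : Type u) where
  blk : V → I
  pb : I → I
  X : I → Finset V
  card_le : ∀ i, (X i).card ≤ a
  blk_of_mem : ∀ i y, y ∈ X i → blk y = pb i
  far : ∀ i y x, y ∈ X i → x ∈ X (pb i) → ¬ G.edist y x ≤ F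
  adj : ∀ u v, G.Adj u v → blk u = blk v ∨ u ∈ X (blk v) ∨ v ∈ X (blk u)

/-- A short walk cannot cross two levels of blocks, since consecutive adhesion sets are more than
`F` apart. Only the same block, parent and child, or siblings remain, and each crossing leaves a
nearby adhesion vertex. -/
theorem BlockDec.cases_of_edist_le {a F : ℕ} {I : Type u} (B : BlockDec G a F I) {u w : V} {n : ℕ}
    (hn : n ≤ F) (h : G.edist u w ≤ n) :
    B.blk w = B.blk u ∨
    (B.pb (B.blk w) = B.blk u ∧ ∃ x ∈ B.X (B.blk w), G.edist x w ≤ n ∧ G.edist u x ≤ n) ∨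
    (B.pb (B.blk u) = B.blk w ∧ ∃ x ∈ B.X (B.blk u), G.edist u x ≤ n ∧ G.edist x w ≤ n) ∨
    (B.pb (B.blk u) = B.pb (B.blk w) ∧
      (∃ x ∈ B.X (B.blk u), G.edist u x ≤ n ∧ G.edist x w ≤ n) ∧
      ∃ x ∈ B.X (B.blk w), G.edist x w ≤ n) := by
  induction n generalizing w with
  | zero =>
    left
    have : u = w := by simpa using h
    rw [this]
  | succ n ih =>
    have up : ∀ {x y}, G.edist x y ≤ n → G.edist x y ≤ (n + 1 : ℕ) := fun h =>
      h.trans (by exact_mod_cast Nat.le_succ n)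
    rcases edist_le_succ h with h' | ⟨w', h', hadj⟩
    · rcases ih (by omega) h' with h | ⟨h, x, hx, h1, h2⟩ | ⟨h, x, hx, h1, h2⟩ |
        ⟨h, ⟨x, hx, h1, h2⟩, x', hx', h3⟩
      · exact Or.inl h
      · exact Or.inr (Or.inl ⟨h, x, hx, up h1, up h2⟩)
      · exact Or.inr (Or.inr (Or.inl ⟨h, x, hx, up h1, up h2⟩))
      · exact Or.inr (Or.inr (Or.inr ⟨h, ⟨x, hx, up h1, up h2⟩, x', hx', up h3⟩))
    have step : ∀ {x}, G.edist x w' ≤ n → G.edist x w ≤ (n + 1 : ℕ) := fun h =>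
      edist_le_add h hadj.edist_le_one le_rfl
    have one : G.edist w' w ≤ (n + 1 : ℕ) :=
      hadj.edist_le_one.trans (by exact_mod_cast Nat.le_add_left _ _)
    have nF : ∀ {x y}, G.edist x y ≤ (n + 1 : ℕ) → G.edist x y ≤ F := fun h =>
      h.trans (by exact_mod_cast hn)
    rcases ih (by omega) h' with h | ⟨h, x, hx, h1, h2⟩ | ⟨h, x, hx, h1, h2⟩ |
      ⟨h, ⟨x, hx, h1, h2⟩, x', hx', h3⟩
    · rcases B.adj _ _ hadj with e | e | e
      · exact Or.inl (e.symm.trans h)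
      · exact Or.inr (Or.inl ⟨(B.blk_of_mem _ _ e).symm.trans h, w', e, one, up h'⟩)
      · refine Or.inr (Or.inr (Or.inl ?_))
        rw [h] at e
        exact ⟨(B.blk_of_mem _ _ e).symm, w, e, step h', by simp⟩
    · rcases B.adj _ _ hadj with e | e | e
      · rw [e] at h hx
        exact Or.inr (Or.inl ⟨h, x, hx, step h1, up h2⟩)
      · rw [B.blk_of_mem _ _ e] at hx
        rw [edist_comm] at h1
        exact absurd (nF (up h1)) (B.far _ _ _ e hx)
      · exact Or.inl ((B.blk_of_mem _ _ e).trans h)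
    · rcases B.adj _ _ hadj with e | e | e
      · exact Or.inr (Or.inr (Or.inl ⟨h.trans e, x, hx, up h1, step h2⟩))
      · exact Or.inr (Or.inr (Or.inr ⟨h.trans (B.blk_of_mem _ _ e), ⟨x, hx, up h1, step h2⟩,
          w', e, one⟩))
      · rw [← h] at e
        exact absurd (nF (step h2)) (B.far _ _ _ hx e)
    · rcases B.adj _ _ hadj with e | e | e
      · rw [e] at h hx'
        exact Or.inr (Or.inr (Or.inr ⟨h, ⟨x, hx, up h1, step h2⟩, x', hx', step h3⟩))
      · rw [B.blk_of_mem _ _ e] at hx'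
        rw [edist_comm] at h3
        exact absurd (nF (up h3)) (B.far _ _ _ e hx')
      · exact Or.inr (Or.inr (Or.inl ⟨h.trans (B.blk_of_mem _ _ e).symm, x, hx, up h1, step h2⟩))

/-! ### Distance profiles and the profile graph. -/

/-- A distance truncated at `r`. -/
noncomputable def trunc (r : ℕ) (e : ℕ∞) : ℕ := (min e r).toNat

theorem coe_trunc (r : ℕ) (e : ℕ∞) : (trunc r e : ℕ∞) = min e r :=
  ENat.natCast_toNat ((min_le_right e r).trans_lt (ENat.natCast_lt_top r)).ne

theorem trunc_le (r : ℕ) (e : ℕ∞) : trunc r e ≤ r := by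
  have : (trunc r e : ℕ∞) ≤ r := by rw [coe_trunc]; exact min_le_right _ _
  exact_mod_cast this

theorem trunc_eq_of_le {r : ℕ} {e : ℕ∞} (h : (r : ℕ∞) ≤ e) : trunc r e = r := by
  have := coe_trunc r e
  rw [min_eq_right h] at this
  exact_mod_cast this

theorem trunc_le_succ {r : ℕ} {e f : ℕ∞} (h : e ≤ f + 1) : trunc r e ≤ trunc r f + 1 := by
  have : (trunc r e : ℕ∞) ≤ (trunc r f : ℕ∞) + 1 := by
    rw [coe_trunc, coe_trunc]
    rcases le_total f r with hf | hf
    · rw [min_eq_left hf]; exact (min_le_left _ _).trans h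
    · rw [min_eq_right hf]; exact (min_le_right _ _).trans le_self_add
  exact_mod_cast this

/-- Admissible distance profiles `τ`, truncated at `r`, towards a nonempty set `C` of diameter at
most `r`. -/
def IsProfile (G : SimpleGraph V) (ok : Finset V → Prop) (M : ℕ) (C : Finset V) (r : ℕ)
    (τ : V → ℕ) : Prop :=
  ok C ∧ C.Nonempty ∧ r ≤ M ∧ (∀ x ∈ C, ∀ y ∈ C, G.edist x y ≤ r) ∧ (∀ x ∈ C, τ x ≤ r) ∧
    ∀ x, x ∉ C → τ x = 0

/-- A profile records only distances to `C`, so vertices of different child blocks may share one.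
This keeps the number of profiles bounded however many children there are. -/
inductive ProfileRel (G : SimpleGraph V) (P : Set V) (ok : Finset V → Prop) (M : ℕ) :
    V ⊕ (Finset V × ℕ × (V → ℕ)) → V ⊕ (Finset V × ℕ × (V → ℕ)) → Prop
  | vert {u v} : G.Adj u v → u ∈ P → v ∈ P → ProfileRel G P ok M (.inl u) (.inl v)
  | mix {v C r τ} : v ∈ C → v ∈ P → G.IsProfile ok M C r τ →
      (∀ x ∈ C, τ x ≤ trunc r (G.edist v x) + 1) → (∀ x ∈ C, trunc r (G.edist v x) ≤ τ x + 1) →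
      ProfileRel G P ok M (.inl v) (.inr (C, r, τ))
  | prof {C r τ τ'} : G.IsProfile ok M C r τ → G.IsProfile ok M C r τ' →
      (∀ x ∈ C, τ x ≤ τ' x + 1) → (∀ x ∈ C, τ' x ≤ τ x + 1) →
      ProfileRel G P ok M (.inr (C, r, τ)) (.inr (C, r, τ'))

/-- The graph induced on `P`, together with a graph of distance profiles glued along each
admissible set `C`; the profiles stand for the vertices outside of `P` close to `C`. -/
def profileGraph (G : SimpleGraph V) (P : Set V) (ok : Finset V → Prop) (M : ℕ) :
    SimpleGraph (V ⊕ (Finset V × ℕ × (V → ℕ))) :=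
  SimpleGraph.fromRel (ProfileRel G P ok M)

/-- The distance to `z`, extended to profiles. -/
noncomputable def profileDist (G : SimpleGraph V) (z : V) : V ⊕ (Finset V × ℕ × (V → ℕ)) → ℕ∞
  | .inl v => G.edist z v
  | .inr (C, _, τ) => C.inf fun x => G.edist z x + τ x

theorem exists_profileDist_eq {ok : Finset V → Prop} {M r : ℕ} {C : Finset V} {τ : V → ℕ}
    (h : G.IsProfile ok M C r τ) (z : V) :
    ∃ x ∈ C, G.profileDist z (.inr (C, r, τ)) = G.edist z x + τ x :=
  Finset.exists_mem_eq_inf C h.2.1 _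

theorem profileDist_le {r : ℕ} {C : Finset V} {τ : V → ℕ} {x : V} (hx : x ∈ C) (z : V) :
    G.profileDist z (.inr (C, r, τ)) ≤ G.edist z x + τ x :=
  Finset.inf_le (f := fun x => G.edist z x + (τ x : ℕ∞)) hx

/-- The extended distance is 1-Lipschitz, so identifying vertices with equal profiles creates no
long shortcuts. In the case `mix` truncation is harmless, as `C` has diameter at most `r`. -/
theorem profileDist_le_of_adj {P : Set V} {ok : Finset V → Prop} {M : ℕ} {z : V}
    {p q : V ⊕ (Finset V × ℕ × (V → ℕ))} (h : (G.profileGraph P ok M).Adj p q) :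
    G.profileDist z q ≤ G.profileDist z p + 1 := by
  have key : ∀ {p q}, ProfileRel G P ok M p q →
      G.profileDist z q ≤ G.profileDist z p + 1 ∧ G.profileDist z p ≤ G.profileDist z q + 1 := by
    intro p q h
    cases h with
    | vert h _ _ =>
      exact ⟨G.edist_triangle.trans (add_le_add_right (by simpa using h.edist_le_one) _),
        G.edist_triangle.trans (add_le_add_right (by simpa using h.symm.edist_le_one) _)⟩
    | @mix v C r τ hv _ hC h1 h2 =>
      constructor
      · refine (profileDist_le hv z).trans (add_le_add_right ?_ _)
        have := h1 v hv
        have h0 : trunc r (G.edist v v) = 0 := by simp [trunc]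
        rw [h0] at this
        exact_mod_cast this
      · obtain ⟨x, hx, he⟩ := exists_profileDist_eq hC z
        rw [he, add_assoc]
        refine G.edist_triangle.trans (add_le_add_right ?_ _)
        have h3 : (trunc r (G.edist v x) : ℕ∞) = G.edist v x := by
          rw [coe_trunc, min_eq_left (hC.2.2.2.1 v hv x hx)]
        rw [edist_comm, ← h3]
        exact_mod_cast h2 x hx
    | @prof C r τ τ' h h' h1 h2 =>
      constructor
      · obtain ⟨x, hx, he⟩ := exists_profileDist_eq h z
        rw [he, add_assoc]
        exact (profileDist_le hx z).trans (add_le_add_right (by exact_mod_cast h2 x hx) _)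
      · obtain ⟨x, hx, he⟩ := exists_profileDist_eq h' z
        rw [he, add_assoc]
        exact (profileDist_le hx z).trans (add_le_add_right (by exact_mod_cast h1 x hx) _)
  rw [profileGraph, fromRel_adj] at h
  exact h.2.elim (fun h => (key h).1) (fun h => (key h).2)

theorem profileDist_le_add {P : Set V} {ok : Finset V → Prop} {M n : ℕ} (z : V)
    {p q : V ⊕ (Finset V × ℕ × (V → ℕ))} (h : (G.profileGraph P ok M).edist p q ≤ n) :
    G.profileDist z q ≤ G.profileDist z p + n := by
  induction n generalizing q with
  | zero =>
    have : p = q := by simpa using h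
    simp [this]
  | succ n ih =>
    rcases edist_le_succ h with h | ⟨w, h, hadj⟩
    · exact (ih h).trans (add_le_add_right (by exact_mod_cast Nat.le_succ n) _)
    · refine (profileDist_le_of_adj hadj).trans ((add_le_add_left (ih h) 1).trans ?_)
      rw [add_assoc]
      push_cast
      exact le_rfl

/-! ### The map from the surroundings of a block to its profile graph. -/

namespace BlockDec

variable {a F : ℕ} {I : Type u} (B : BlockDec G a F I) (ℓ : ℕ) (r : I → ℕ)

/-- `v` is at distance at most `r + k * ℓ` from the adhesion set of its block. -/
def Near (k : ℕ) (v : V) : Prop :=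
  ∃ x ∈ B.X (B.blk v), G.edist v x ≤ (r (B.blk v) + k * ℓ : ℕ)

open Classical in
/-- A vertex of the adhesion set close to `v`, if there is one. -/
noncomputable def center (v : V) : V :=
  if h : B.Near ℓ r 4 v then h.choose else v

open Classical in
/-- The part of the adhesion set close to `v`. -/
noncomputable def cluster (v : V) : Finset V :=
  (B.X (B.blk v)).filter fun y => G.edist (B.center ℓ r v) y ≤ r (B.blk v)

open Classical in
/-- The truncated distances from `v` to the close part of the adhesion set. -/
noncomputable def profile (v x : V) : ℕ :=
  if x ∈ B.cluster ℓ r v then trunc (r (B.blk v)) (G.edist v x) else 0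

open Classical in
/-- The image of `v` in the profile graph of the block `b`. -/
noncomputable def toProfile (b : I) (v : V) : V ⊕ (Finset V × ℕ × (V → ℕ)) :=
  if B.blk v = b then .inl v else .inr (B.cluster ℓ r v, r (B.blk v), B.profile ℓ r v)

/-- The vertices of the block `b` far from its adhesion set. -/
def farPart (b : I) : Set V := {v | B.blk v = b ∧ ∀ x ∈ B.X b, ¬ G.edist x v ≤ F}

def IsChild (b : I) (C : Finset V) : Prop := ∃ j, B.pb j = b ∧ C ⊆ B.X j

/-- `r i` is a gap in the set of distances between the vertices of `X i`. -/
def IsGap (M : ℕ) : Prop :=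
  ∀ i, ℓ ≤ r i ∧ r i ≤ M ∧ ∀ x ∈ B.X i, ∀ y ∈ B.X i, G.edist x y ≤ (16 * r i : ℕ) →
    G.edist x y ≤ r i

variable {B ℓ r} {M : ℕ}

theorem Near.mono {k m : ℕ} {v : V} (h : B.Near ℓ r k v) (hkm : k ≤ m) : B.Near ℓ r m v := by
  obtain ⟨x, hx, h⟩ := h
  have := Nat.mul_le_mul_right ℓ hkm
  exact ⟨x, hx, h.trans (by norm_cast; omega)⟩

theorem center_spec {v : V} (h : B.Near ℓ r 4 v) : B.center ℓ r v ∈ B.X (B.blk v) ∧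
    G.edist v (B.center ℓ r v) ≤ (r (B.blk v) + 4 * ℓ : ℕ) := by
  rw [center, dif_pos h]
  exact h.choose_spec

theorem cluster_subset (v : V) : B.cluster ℓ r v ⊆ B.X (B.blk v) := Finset.filter_subset _ _

theorem mem_cluster (hr : B.IsGap ℓ r M) {v x : V} (hx : x ∈ B.X (B.blk v))
    (hvx : G.edist v x ≤ (r (B.blk v) + 4 * ℓ : ℕ)) : x ∈ B.cluster ℓ r v := by
  obtain ⟨h1, -, h2⟩ := hr (B.blk v)
  obtain ⟨h3, h4⟩ := center_spec (⟨x, hx, hvx⟩ : B.Near ℓ r 4 v)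
  rw [cluster, Finset.mem_filter]
  rw [edist_comm] at h4
  exact ⟨hx, h2 _ h3 _ hx (edist_le_add h4 hvx (by omega))⟩

theorem edist_le_of_mem_cluster (hr : B.IsGap ℓ r M) {v x y : V} (hx : x ∈ B.cluster ℓ r v)
    (hy : y ∈ B.cluster ℓ r v) : G.edist x y ≤ r (B.blk v) := by
  rw [cluster, Finset.mem_filter] at hx hy
  have h := hx.2
  rw [edist_comm] at h
  exact (hr (B.blk v)).2.2 _ hx.1 _ hy.1 (edist_le_add h hy.2 (by omega))

theorem edist_le_of_near_of_mem_cluster (hr : B.IsGap ℓ r M) {v x : V} (hv : B.Near ℓ r 4 v)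
    (hx : x ∈ B.cluster ℓ r v) : G.edist v x ≤ (6 * r (B.blk v) : ℕ) := by
  have h1 := (hr (B.blk v)).1
  obtain ⟨-, h4⟩ := center_spec hv
  rw [cluster, Finset.mem_filter] at hx
  exact edist_le_add h4 hx.2 (by omega)

/-- The two centers are within `2 * r + 9 * ℓ ≤ 11 * r`, hence within `r` by the gap, so they select
the same vertices. -/
theorem cluster_eq (hr : B.IsGap ℓ r M) {u v : V} (huv : B.blk u = B.blk v)
    (hu : B.Near ℓ r 4 u) (hv : B.Near ℓ r 4 v) (h : G.edist u v ≤ ℓ) :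
    B.cluster ℓ r u = B.cluster ℓ r v := by
  obtain ⟨h1, -, h2⟩ := hr (B.blk v)
  obtain ⟨hu1, hu2⟩ := center_spec hu
  obtain ⟨hv1, hv2⟩ := center_spec hv
  rw [huv] at hu1 hu2
  rw [edist_comm] at hu2
  have hc := h2 _ hu1 _ hv1 (edist_le_add (edist_le_add hu2 h le_rfl) hv2 (by omega))
  ext y
  rw [cluster, cluster, Finset.mem_filter, Finset.mem_filter, huv]
  refine and_congr_right fun hy => ⟨fun hy' => ?_, fun hy' => ?_⟩
  · rw [edist_comm] at hc
    exact h2 _ hv1 _ hy (edist_le_add hc hy' (by omega))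
  · exact h2 _ hu1 _ hy (edist_le_add hc hy' (by omega))

theorem isProfile_of_near (hr : B.IsGap ℓ r M) {v : V} (hv : B.Near ℓ r 4 v) {τ : V → ℕ}
    (h1 : ∀ x ∈ B.cluster ℓ r v, τ x ≤ r (B.blk v)) (h2 : ∀ x ∉ B.cluster ℓ r v, τ x = 0) :
    G.IsProfile (B.IsChild (B.pb (B.blk v))) M (B.cluster ℓ r v) (r (B.blk v)) τ :=
  ⟨⟨_, rfl, cluster_subset v⟩, ⟨_, mem_cluster hr (center_spec hv).1 (center_spec hv).2⟩,
    (hr _).2.1, fun _ hx _ hy => edist_le_of_mem_cluster hr hx hy, h1, h2⟩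

theorem profile_of_mem {v x : V} (hx : x ∈ B.cluster ℓ r v) :
    B.profile ℓ r v x = trunc (r (B.blk v)) (G.edist v x) := if_pos hx

theorem profile_of_notMem {v x : V} (hx : x ∉ B.cluster ℓ r v) : B.profile ℓ r v x = 0 := if_neg hx

theorem isProfile_profile (hr : B.IsGap ℓ r M) {v : V} (hv : B.Near ℓ r 4 v) :
    G.IsProfile (B.IsChild (B.pb (B.blk v))) M (B.cluster ℓ r v) (r (B.blk v))
      (B.profile ℓ r v) :=
  isProfile_of_near hr hv (fun x hx => by rw [profile_of_mem hx]; exact trunc_le _ _)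
    fun x hx => profile_of_notMem hx

theorem pb_ne {i : I} {x : V} (hx : x ∈ B.X i) : B.pb i ≠ i := by
  intro h
  exact B.far i x x hx (h.symm ▸ hx) (by simp)

/-- The vertices that are mapped to non-isolated vertices of the profile graph of the block `b`. -/
def IsRegular (B : BlockDec G a F I) (ℓ : ℕ) (r : I → ℕ) (b : I) (w : V) : Prop :=
  w ∈ B.farPart b ∨ B.blk w ≠ b ∧ B.pb (B.blk w) = b ∧ B.Near ℓ r 3 w

theorem toProfile_of_eq {b : I} {v : V} (h : B.blk v = b) : B.toProfile ℓ r b v = .inl v :=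
  if_pos h

theorem toProfile_of_ne {b : I} {v : V} (h : B.blk v ≠ b) : B.toProfile ℓ r b v =
    .inr (B.cluster ℓ r v, r (B.blk v), B.profile ℓ r v) := if_neg h

theorem toProfile_eq_or_adj (hr : B.IsGap ℓ r M) (hℓ : 1 ≤ ℓ) (hF : 1 ≤ F) {b : I} {u v : V}
    (hu : B.IsRegular ℓ r b u) (hv : B.IsRegular ℓ r b v) (h : G.Adj u v) :
    B.toProfile ℓ r b u = B.toProfile ℓ r b v ∨
      (G.profileGraph (B.farPart b) (B.IsChild b) M).Adj (B.toProfile ℓ r b u)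
        (B.toProfile ℓ r b v) := by
  have hmix : ∀ u v, G.Adj u v → u ∈ B.farPart b → B.blk v ≠ b → B.pb (B.blk v) = b →
      B.Near ℓ r 3 v → ProfileRel G (B.farPart b) (B.IsChild b) M (B.toProfile ℓ r b u)
        (B.toProfile ℓ r b v) := by
    intro u v h hu hv hvb hvn
    rw [toProfile_of_eq hu.1, toProfile_of_ne hv]
    have hux : u ∈ B.X (B.blk v) := by
      rcases B.adj u v h with e | e | e
      · exact absurd (e.symm.trans hu.1) hv
      · exact e
      · rw [hu.1] at e
        exact absurd (h.symm.edist_le_one.trans (by exact_mod_cast hF)) (hu.2 _ e)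
    have huc : u ∈ B.cluster ℓ r v :=
      mem_cluster hr hux (h.symm.edist_le_one.trans (by norm_cast; omega))
    have hp := isProfile_profile hr (hvn.mono (by norm_num : 3 ≤ 4))
    rw [hvb] at hp
    refine .mix huc hu hp (fun x hx => ?_) (fun x hx => ?_)
    · rw [profile_of_mem hx]
      refine trunc_le_succ ?_
      rw [add_comm]
      exact G.edist_triangle.trans (add_le_add_left (by simpa using h.symm.edist_le_one) _)
    · rw [profile_of_mem hx]
      refine trunc_le_succ ?_
      rw [add_comm]
      exact G.edist_triangle.trans (add_le_add_left (by simpa using h.edist_le_one) _)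
  refine or_iff_not_imp_left.2 fun hne => ?_
  rw [profileGraph, fromRel_adj]
  refine ⟨hne, ?_⟩
  rcases hu with hu | ⟨hu, hub, hun⟩ <;> rcases hv with hv | ⟨hv, hvb, hvn⟩
  · rw [toProfile_of_eq hu.1, toProfile_of_eq hv.1]
    exact Or.inl (.vert h hu hv)
  · exact Or.inl (hmix u v h hu hv hvb hvn)
  · exact Or.inr (hmix v u h.symm hv hu hub hun)
  · left
    have e : B.blk u = B.blk v := by
      rcases B.adj u v h with e | e | e
      · exact e
      · exact absurd ((B.blk_of_mem _ _ e).trans hvb) hu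
      · exact absurd ((B.blk_of_mem _ _ e).trans hub) hv
    have hc := cluster_eq hr e (hun.mono (by norm_num)) (hvn.mono (by norm_num))
      (h.edist_le_one.trans (by exact_mod_cast hℓ))
    have hpu := isProfile_profile hr (hun.mono (by norm_num : 3 ≤ 4))
    have hpv := isProfile_profile hr (hvn.mono (by norm_num : 3 ≤ 4))
    rw [toProfile_of_ne hu, toProfile_of_ne hv]
    rw [hub, e, hc] at hpu
    rw [hvb] at hpv
    rw [hc, e]
    refine .prof hpu hpv (fun x hx => ?_) (fun x hx => ?_)
    · rw [profile_of_mem hx, profile_of_mem (hc ▸ hx), e]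
      refine trunc_le_succ ?_
      rw [add_comm]
      exact G.edist_triangle.trans (add_le_add_left (by simpa using h.edist_le_one) _)
    · rw [profile_of_mem hx, profile_of_mem (hc ▸ hx), e]
      refine trunc_le_succ ?_
      rw [add_comm]
      exact G.edist_triangle.trans (add_le_add_left (by simpa using h.symm.edist_le_one) _)

open Classical in
/-- The block to which `v` is assigned: vertices close to the adhesion set of their block are passed
to the parent block. -/
noncomputable def owner (B : BlockDec G a F I) (ℓ : ℕ) (r : I → ℕ) (v : V) : I :=
  if B.Near ℓ r 2 v then B.pb (B.blk v) else B.blk v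

theorem owner_of_near {v : V} (h : B.Near ℓ r 2 v) : B.owner ℓ r v = B.pb (B.blk v) := if_pos h

theorem owner_of_not_near {v : V} (h : ¬ B.Near ℓ r 2 v) : B.owner ℓ r v = B.blk v := if_neg h

/-- The vertices assigned to `b` and far from its adhesion set. -/
def core (B : BlockDec G a F I) (ℓ : ℕ) (r : I → ℕ) (b : I) : Set V :=
  {v | B.owner ℓ r v = b ∧ ∀ x ∈ B.X b, ¬ G.edist x v ≤ (F + ℓ : ℕ)}

/-- One jump raises nearness from level 2 to level 3 at most. It cannot reach a grandchild block
from a child vertex owned by `b`, nor the parent block from the core. -/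
theorem isRegular_of_edist_le (hr : B.IsGap ℓ r M) (hF : 16 * M ≤ F) {b : I} {u w : V}
    (hu : u ∈ B.core ℓ r b) (h : G.edist u w ≤ ℓ) : B.IsRegular ℓ r b w := by
  obtain ⟨hub, hufar⟩ := hu
  have hwfar : ∀ x ∈ B.X b, ¬ G.edist x w ≤ F := by
    intro x hx hxw
    rw [edist_comm] at h
    exact hufar x hx (edist_le_add hxw h le_rfl)
  have hMℓ : ℓ ≤ M := (hr b).1.trans (hr b).2.1
  have near3 : ∀ {x}, x ∈ B.X (B.blk w) → G.edist x w ≤ ℓ → B.Near ℓ r 3 w := by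
    intro x hx hxw
    rw [edist_comm] at hxw
    exact ⟨x, hx, hxw.trans (by norm_cast; omega)⟩
  by_cases hn : B.Near ℓ r 2 u
  · rw [owner_of_near hn] at hub
    obtain ⟨y, hy, huy⟩ := hn
    rcases B.cases_of_edist_le (by omega) h with e | ⟨e, x, hx, h1, h2⟩ | ⟨e, x, hx, h1, h2⟩ |
      ⟨e, -, x, hx, h1⟩
    · right
      have hy' := hy
      rw [← e] at hy'
      refine ⟨?_, by rw [e]; exact hub, y, hy', ?_⟩
      · rintro rfl
        exact pb_ne hy' (by rw [e]; exact hub.trans e)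
      · rw [edist_comm] at h
        rw [e]
        exact edist_le_add h huy (by omega)
    · rw [← e] at hy huy
      rw [edist_comm] at h2
      have := hr (B.pb (B.blk w))
      exact absurd (edist_le_add h2 huy (by omega)) (B.far _ _ _ hx hy)
    · exact Or.inl ⟨e.symm.trans hub, hwfar⟩
    · refine Or.inr ⟨?_, e.symm.trans hub, near3 hx h1⟩
      rintro rfl
      exact pb_ne hx (e.symm.trans hub)
  · rw [owner_of_not_near hn] at hub
    have hno : ∀ x ∈ B.X (B.blk u), ¬ G.edist u x ≤ ℓ := fun x hx hux =>
      hn ⟨x, hx, hux.trans (by norm_cast; omega)⟩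
    rcases B.cases_of_edist_le (by omega) h with e | ⟨e, x, hx, h1, h2⟩ | ⟨e, x, hx, h1, h2⟩ |
      ⟨e, ⟨x, hx, h1, -⟩, -⟩
    · exact Or.inl ⟨e.trans hub, hwfar⟩
    · refine Or.inr ⟨?_, e.trans hub, near3 hx h1⟩
      rintro rfl
      exact pb_ne hx (e.trans hub)
    · exact absurd h1 (hno x hx)
    · exact absurd h1 (hno x hx)

theorem edist_toProfile_le (hr : B.IsGap ℓ r M) (hℓ : 1 ≤ ℓ) (hF : 16 * M ≤ F) {b : I} {u w : V}
    (hu : u ∈ B.core ℓ r b) (h : G.edist u w ≤ ℓ) :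
    (G.profileGraph (B.farPart b) (B.IsChild b) M).edist (B.toProfile ℓ r b u)
      (B.toProfile ℓ r b w) ≤ ℓ := by
  have hMℓ : ℓ ≤ M := (hr b).1.trans (hr b).2.1
  suffices ∀ n ≤ ℓ, ∀ w, G.edist u w ≤ n →
      (G.profileGraph (B.farPart b) (B.IsChild b) M).edist (B.toProfile ℓ r b u)
        (B.toProfile ℓ r b w) ≤ n from this ℓ le_rfl w h
  intro n
  induction n with
  | zero =>
    intro _ w h
    have : u = w := by simpa using h
    simp [this]
  | succ n ih =>
    intro hn w h
    rcases edist_le_succ h with h' | ⟨w', h', hadj⟩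
    · exact (ih (by omega) w h').trans (by exact_mod_cast Nat.le_succ n)
    · have h1 := ih (by omega) w' h'
      rcases toProfile_eq_or_adj hr hℓ (by omega)
        (isRegular_of_edist_le hr hF hu (h'.trans (by norm_cast; omega)))
        (isRegular_of_edist_le hr hF hu (h.trans (by exact_mod_cast hn))) hadj with e | e
      · rw [← e]
        exact h1.trans (by exact_mod_cast Nat.le_succ n)
      · exact edist_le_add h1 e.edist_le_one le_rfl

/-- The error `13 * M` splits as `7 * M`, for the extended distance from `u` to its own image, and
`6 * M`, for the way from the cluster of `v` to `v`. -/
theorem edist_le_of_edist_toProfile_le (hr : B.IsGap ℓ r M) {b : I} {u v : V} {D : ℕ}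
    (hu : B.owner ℓ r u = b) (hv : B.owner ℓ r v = b)
    (h : (G.profileGraph (B.farPart b) (B.IsChild b) M).edist (B.toProfile ℓ r b u)
      (B.toProfile ℓ r b v) ≤ D) : G.edist u v ≤ (D + 13 * M : ℕ) := by
  have near : ∀ {w}, B.owner ℓ r w = b → B.blk w ≠ b → B.Near ℓ r 4 w := by
    intro w hw hb
    by_contra hcon
    exact hb (owner_of_not_near (fun h => hcon (h.mono (by norm_num))) ▸ hw)
  have hu0 : G.profileDist u (B.toProfile ℓ r b u) ≤ (7 * M : ℕ) := by
    by_cases hb : B.blk u = b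
    · rw [toProfile_of_eq hb]
      simp [profileDist]
    · rw [toProfile_of_ne hb]
      have hn := near hu hb
      obtain ⟨h1, h2⟩ := center_spec hn
      have hm := mem_cluster hr h1 h2
      refine (profileDist_le hm u).trans ?_
      have h3 : B.profile ℓ r u (B.center ℓ r u) ≤ r (B.blk u) := by
        rw [profile_of_mem hm]; exact trunc_le _ _
      have h4 := edist_le_of_near_of_mem_cluster hr hn hm
      have h5 := (hr (B.blk u)).2.1
      refine (add_le_add h4 (by exact_mod_cast h3 :
        (B.profile ℓ r u (B.center ℓ r u) : ℕ∞) ≤ (r (B.blk u) : ℕ))).trans ?_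
      norm_cast
      omega
  have hv0 : G.edist u v ≤ G.profileDist u (B.toProfile ℓ r b v) + (6 * M : ℕ) := by
    by_cases hb : B.blk v = b
    · rw [toProfile_of_eq hb]
      exact le_self_add
    · rw [toProfile_of_ne hb]
      have hn := near hv hb
      obtain ⟨x, hx, he⟩ := exists_profileDist_eq (isProfile_profile hr hn) u
      rw [he, add_assoc]
      refine G.edist_triangle.trans (add_le_add_right ?_ _)
      have h4 := edist_le_of_near_of_mem_cluster hr hn hx
      have h5 := (hr (B.blk v)).2.1
      rw [edist_comm]
      refine (h4.trans ?_).trans le_add_self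
      norm_cast
      omega
  have h1 := profileDist_le_add u h
  refine hv0.trans ((add_le_add_left (h1.trans (add_le_add_left hu0 _)) _).trans ?_)
  norm_cast
  omega

end BlockDec

/-! ### Gluing the colorings of the profile graphs. -/

namespace BlockDec

variable {a F : ℕ} {I : Type u} {B : BlockDec G a F I} {ℓ : ℕ} {r : I → ℕ} {M : ℕ}
  {c : I → V ⊕ (Finset V × ℕ × (V → ℕ)) → Bool}

open Classical in
/-- The colouring of `G` obtained from colourings of the profile graphs: a vertex close to the
adhesion set of its block is coloured in the parent block, and is separated from the rest of its
block by a ring in the opposite colour. -/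
noncomputable def coloring (B : BlockDec G a F I) (ℓ : ℕ) (r : I → ℕ)
    (c : I → V ⊕ (Finset V × ℕ × (V → ℕ)) → Bool) (v : V) : Bool :=
  if B.Near ℓ r 2 v then
    c (B.pb (B.blk v)) (.inr (B.cluster ℓ r v, r (B.blk v), B.profile ℓ r v))
  else if B.Near ℓ r 4 v then
    !c (B.pb (B.blk v)) (.inr (B.cluster ℓ r v, r (B.blk v),
      fun x => if x ∈ B.cluster ℓ r v then r (B.blk v) else 0))
  else c (B.blk v) (.inl v)

theorem coloring_of_mem_core (hr : B.IsGap ℓ r M) (hF : 16 * M ≤ F) {b : I} {v : V}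
    (hv : v ∈ B.core ℓ r b) : B.coloring ℓ r c v = c b (B.toProfile ℓ r b v) := by
  obtain ⟨hb, hfar⟩ := hv
  by_cases hn : B.Near ℓ r 2 v
  · rw [owner_of_near hn] at hb
    rw [coloring, if_pos hn, toProfile_of_ne, hb]
    obtain ⟨x, hx, -⟩ := hn
    exact fun h => pb_ne hx (hb.trans h.symm)
  · rw [owner_of_not_near hn] at hb
    have hn4 : ¬ B.Near ℓ r 4 v := by
      rintro ⟨x, hx, hxv⟩
      rw [hb] at hx hxv
      rw [edist_comm] at hxv
      have := hr b
      exact hfar x hx (hxv.trans (by norm_cast; omega))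
    rw [coloring, if_neg hn, if_neg hn4, toProfile_of_eq hb, hb]

theorem coloring_ne (hr : B.IsGap ℓ r M) {u v : V} (he : B.blk u = B.blk v)
    (hu : B.Near ℓ r 2 u) (hv : ¬ B.Near ℓ r 2 v) (h : G.edist u v ≤ ℓ) :
    B.coloring ℓ r c u ≠ B.coloring ℓ r c v := by
  classical
  have hv4 : B.Near ℓ r 4 v := by
    obtain ⟨x, hx, hux⟩ := hu
    rw [he] at hx hux
    rw [edist_comm] at h
    exact ⟨x, hx, edist_le_add h hux (by omega)⟩
  have hc := cluster_eq hr he (hu.mono (by norm_num)) hv4 h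
  -- As `v` is beyond `r + 2 * ℓ`, `u` is beyond `r + ℓ` from the cluster: its profile is constantly
  -- `r`, the one whose color the ring negates.
  have hp : B.profile ℓ r u = fun x => if x ∈ B.cluster ℓ r v then r (B.blk v) else 0 := by
    funext x
    by_cases hx : x ∈ B.cluster ℓ r v
    · rw [if_pos hx, profile_of_mem (hc ▸ hx), he]
      refine trunc_eq_of_le ?_
      by_contra! hlt
      rw [edist_comm] at h
      exact hv ⟨x, cluster_subset v hx, edist_le_add h hlt.le (by omega)⟩
    · rw [if_neg hx, profile_of_notMem (hc ▸ hx)]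
  rw [coloring, coloring, if_pos hu, if_neg hv, if_pos hv4, hp, hc, he]
  exact (Bool.not_ne_self _).symm

/-- Between different blocks the nearness conditions already force equal owners. Colors matter only
within a block, where the ring excludes a change of owner. -/
theorem owner_eq (hr : B.IsGap ℓ r M) (hF : 16 * M ≤ F) {u v : V} (h : G.edist u v ≤ ℓ)
    (hc : B.coloring ℓ r c u = B.coloring ℓ r c v) : B.owner ℓ r u = B.owner ℓ r v := by
  have hMℓ : ℓ ≤ M := (hr (B.blk u)).1.trans (hr (B.blk u)).2.1
  have near : ∀ {x w}, x ∈ B.X (B.blk w) → G.edist w x ≤ ℓ → B.Near ℓ r 2 w := fun hx hxw =>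
    ⟨_, hx, hxw.trans (by norm_cast; omega)⟩
  have hdown : ∀ {u v x}, B.pb (B.blk v) = B.blk u → x ∈ B.X (B.blk v) → G.edist x v ≤ ℓ →
      G.edist u x ≤ ℓ → B.owner ℓ r u = B.owner ℓ r v := by
    intro u v x e hx h1 h2
    rw [edist_comm] at h1
    rw [owner_of_near (near hx h1), owner_of_not_near, e]
    rintro ⟨y, hy, huy⟩
    rw [← e] at hy huy
    rw [edist_comm] at h2
    have := hr (B.pb (B.blk v))
    exact B.far _ _ _ hx hy (edist_le_add h2 huy (by omega))
  rcases B.cases_of_edist_le (by omega) h with e | ⟨e, x, hx, h1, h2⟩ | ⟨e, x, hx, h1, h2⟩ |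
      ⟨e, ⟨x, hx, h1, -⟩, x', hx', h2⟩
  · by_cases hu : B.Near ℓ r 2 u <;> by_cases hv : B.Near ℓ r 2 v
    · rw [owner_of_near hu, owner_of_near hv, e]
    · exact absurd hc (coloring_ne hr e.symm hu hv h)
    · rw [edist_comm] at h
      exact absurd hc.symm (coloring_ne hr e hv hu h)
    · rw [owner_of_not_near hu, owner_of_not_near hv, e]
  · exact hdown e hx h1 h2
  · rw [edist_comm] at h1 h2
    exact (hdown e hx h1 h2).symm
  · rw [edist_comm] at h2
    rw [owner_of_near (near hx h1), owner_of_near (near hx' h2), e]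

/-- A monochromatic chain keeps its owner `b`. Outside the balls around the adhesion set of `b` it
lies in the core, where it maps to a monochromatic chain of the profile graph; the balls, which also
contain the ring vertices owned by `b`, are then added back. -/
theorem isClusterColoring_coloring (hr : B.IsGap ℓ r M) (hℓ : 1 ≤ ℓ) (hF : 16 * M ≤ F) {D : ℕ}
    (hc : ∀ b, (G.profileGraph (B.farPart b) (B.IsChild b) M).IsClusterColoring ℓ D (c b)) :
    G.IsClusterColoring ℓ ((fun D => 2 * (D + ℓ + (F + ℓ)))^[a] (D + 13 * M))
      (B.coloring ℓ r c) := by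
  intro u v huv
  let S : Set V := {w | B.owner ℓ r w = B.owner ℓ r u ∧ B.coloring ℓ r c w = B.coloring ℓ r c u}
  have hS : v ∈ S ∧ Relation.ReflTransGen (fun x y => x ∈ S ∧ y ∈ S ∧ G.edist x y ≤ ℓ) u v := by
    induction huv with
    | refl => exact ⟨⟨rfl, rfl⟩, .refl⟩
    | @tail y z _ h ih =>
      have hz : z ∈ S := ⟨(owner_eq hr hF h.2 h.1).symm.trans ih.1.1, h.1.symm.trans ih.1.2⟩
      exact ⟨hz, ih.2.tail ⟨ih.1, hz, h.2⟩⟩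
  refine IsBoundedOn.of_diff_balls (B.X (B.owner ℓ r u)) (B.card_le _) ?_ u v hS.2
  intro x y hxy
  rcases Relation.ReflTransGen.cases_head hxy with rfl | ⟨x', hx, -⟩
  · simp
  rcases Relation.ReflTransGen.cases_tail hxy with rfl | ⟨y', -, hy⟩
  · simp
  have hcore : ∀ {w}, w ∈ S → (∀ x ∈ B.X (B.owner ℓ r u), ¬ G.edist x w ≤ (F + ℓ : ℕ)) →
      w ∈ B.core ℓ r (B.owner ℓ r u) := fun h h' => ⟨h.1, h'⟩
  refine edist_le_of_edist_toProfile_le hr hx.1.1.1 hy.2.1.1.1 (hc _ _ _ ?_)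
  refine Relation.ReflTransGen.lift (B.toProfile ℓ r (B.owner ℓ r u)) ?_ _ _ hxy
  intro p q hpq
  have hp := hcore hpq.1.1 hpq.1.2
  have hq := hcore hpq.2.1.1 hpq.2.1.2
  refine ⟨?_, edist_toProfile_le hr hℓ hF hp hpq.2.2⟩
  rw [← coloring_of_mem_core (c := c) hr hF hp, ← coloring_of_mem_core (c := c) hr hF hq]
  exact hpq.1.1.2.trans hpq.2.1.1.2.symm

end BlockDec

/-! ### Cutting a tree decomposition into blocks. -/

namespace TreeDec

variable {a w : ℕ} {I : Type u} (d : TreeDec G a w I) (F : ℕ)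

open Classical in
/-- The topmost node of the block containing `i`: a node belongs to the block of its parent if its
adhesion is close to the adhesion of that block. -/
noncomputable def head (i : I) : I :=
  if _h : (d.A i).Nonempty then
    if ∃ y ∈ d.A i, ∃ x ∈ d.A (head (d.par i)), G.edist y x ≤ F then head (d.par i) else i
  else i
termination_by d.dep i
decreasing_by all_goals exact d.dep_lt i _h

theorem head_cases (i : I) :
    (d.head F i = d.head F (d.par i) ∧ d.dep (d.par i) < d.dep i ∧
      ∃ y ∈ d.A i, ∃ x ∈ d.A (d.head F (d.par i)), G.edist y x ≤ F) ∨
    (d.head F i = i ∧ ∀ y ∈ d.A i, ∀ x ∈ d.A (d.head F (d.par i)), ¬ G.edist y x ≤ F) := by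
  rw [head]
  split_ifs with h h'
  · exact Or.inl ⟨rfl, d.dep_lt i h, h'⟩
  · right
    refine ⟨rfl, ?_⟩
    push Not at h'
    intro y hy x hx hc
    exact absurd (h' y hy x hx) (not_lt.2 hc)
  · exact Or.inr ⟨rfl, fun y hy => absurd ⟨y, hy⟩ h⟩

theorem head_induction {P : I → Prop}
    (h : ∀ i, (d.dep (d.par i) < d.dep i → P (d.par i)) → P i) (i : I) : P i := by
  induction hn : d.dep i using Nat.strong_induction_on generalizing i with
  | _ n ih => exact h i fun hlt => ih _ (hn ▸ hlt) _ rfl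

theorem dep_head_le (i : I) : d.dep (d.head F i) ≤ d.dep i := by
  induction i using d.head_induction with
  | h i ih =>
    rcases d.head_cases F i with ⟨h, hlt, -⟩ | ⟨h, -⟩
    · rw [h]; exact (ih hlt).trans hlt.le
    · rw [h]

theorem head_head (i : I) : d.head F (d.head F i) = d.head F i := by
  induction i using d.head_induction with
  | h i ih =>
    rcases d.head_cases F i with ⟨h, hlt, -⟩ | ⟨h, -⟩
    · rw [h]; exact ih hlt
    · rw [h, h]

theorem mem_head {p : I} {y : V} (hy : y ∈ d.A p) :
    y ∈ d.A (d.head F p) ∨ d.head F (d.top y) = d.head F p := by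
  induction p using d.head_induction with
  | h p ih =>
    rcases d.head_cases F p with ⟨h, hlt, -⟩ | ⟨h, -⟩
    · rw [h]
      rcases d.mem_par p y hy with h' | h'
      · exact ih hlt h'
      · exact Or.inr (by rw [h'])
    · rw [h]; exact Or.inl hy

theorem not_edist_le_of_head_eq {b : I} (hb : d.head F b = b) {y x : V} (hy : y ∈ d.A b)
    (hx : x ∈ d.A (d.head F (d.par b))) : ¬ G.edist y x ≤ F := by
  rcases d.head_cases F b with ⟨h, hlt, -⟩ | ⟨-, h⟩
  · have := d.dep_head_le F (d.par b)
    rw [← h, hb] at this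
    omega
  · exact h y hy x hx

/-- The block decomposition of a tree decomposition. -/
noncomputable def toBlockDec : BlockDec G a F I where
  blk v := d.head F (d.top v)
  pb i := d.head F (d.par (d.head F i))
  X i := d.A (d.head F i)
  card_le i := d.card_le _
  blk_of_mem i y hy := by
    have hfar : y ∉ d.A (d.head F (d.par (d.head F i))) := fun h =>
      d.not_edist_le_of_head_eq F (d.head_head F i) hy h (by simp)
    rcases d.mem_par _ y hy with h | h
    · exact (d.mem_head F h).resolve_left hfar
    · rw [h]
  far i y x hy hx := by
    rw [head_head] at hx
    exact d.not_edist_le_of_head_eq F (d.head_head F i) hy hx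
  adj u v h := by
    simp only [head_head]
    rcases d.adj u v h with h | h | h
    · exact Or.inl (by rw [h])
    · exact (d.mem_head F h).symm.imp_right Or.inl
    · rcases d.mem_head F h with h | h
      · exact Or.inr (Or.inr h)
      · exact Or.inl h.symm

end TreeDec

/-! ### Lowering the adhesion, and the induction. -/

theorem exists_finset_profiles (M m : ℕ) (S : Finset V) (hS : S.card ≤ m) :
    ∃ T : Finset (Finset V × ℕ × (V → ℕ)),
      (∀ C r τ, C ⊆ S → r ≤ M → (∀ x ∈ C, τ x ≤ r) → (∀ x, x ∉ C → τ x = 0) → (C, r, τ) ∈ T) ∧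
        T.card ≤ 2 ^ m * ((M + 1) * (M + 1) ^ m) := by
  classical
  let E : Finset (V → ℕ) := (Fintype.piFinset fun _ : S => Finset.range (M + 1)).image
    fun g x => if h : x ∈ S then g ⟨x, h⟩ else 0
  have hE : E.card ≤ (M + 1) ^ m := by
    refine Finset.card_image_le.trans ?_
    rw [Fintype.card_piFinset]
    simpa using Nat.pow_le_pow_right (Nat.succ_pos M) hS
  refine ⟨S.powerset ×ˢ (Finset.range (M + 1) ×ˢ E), ?_, ?_⟩
  · intro C r τ hC hr h1 h2
    simp only [Finset.mem_product, Finset.mem_powerset, Finset.mem_range, E, Finset.mem_image,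
      Fintype.mem_piFinset]
    refine ⟨hC, by omega, fun x => τ x, fun x => ?_, ?_⟩
    · change τ x < M + 1
      by_cases hx : (x : V) ∈ C
      · have := h1 x hx
        omega
      · rw [h2 x hx]
        omega
    · funext x
      split_ifs with hx
      · rfl
      · exact (h2 x fun h => hx (hC h)).symm
  · rw [Finset.card_product, Finset.card_product, Finset.card_powerset, Finset.card_range]
    exact Nat.mul_le_mul (Nat.pow_le_pow_right (by norm_num) hS) (Nat.mul_le_mul_left _ hE)

namespace TreeDec

variable {a w : ℕ} {I : Type u}

/-- The profile graph of a block has a tree decomposition with smaller adhesion. -/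
theorem exists_treeDec_profileGraph (d : TreeDec G (a + 1) w I) (F M : ℕ) (b : I) :
    Nonempty (TreeDec (G.profileGraph ((d.toBlockDec F).farPart b) ((d.toBlockDec F).IsChild b) M)
      a (w + 2 ^ (a + 1 + w) * ((M + 1) * (M + 1) ^ (a + 1 + w)))
      (I ⊕ (V ⊕ (Finset V × ℕ × (V → ℕ))))) := by
  classical
  obtain ⟨P, hP⟩ : ∃ P, P = (d.toBlockDec F).farPart b := ⟨_, rfl⟩
  obtain ⟨ok, hok⟩ : ∃ ok, ok = (d.toBlockDec F).IsChild b := ⟨_, rfl⟩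
  have hPtop : ∀ {y}, y ∈ P → d.head F (d.top y) = b := by
    intro y hy
    rw [hP] at hy
    exact hy.1
  have hPfar : ∀ {y}, y ∈ P → ∀ x ∈ d.A b, ¬ G.edist y x ≤ F := by
    intro y hy x hx
    have hb : d.head F b = b := by rw [← hPtop hy, head_head]
    rw [hP] at hy
    rw [edist_comm]
    exact hy.2 x (by rw [← hb] at hx; exact hx)
  have hPA : ∀ {y}, y ∈ P → y ∉ d.A b := fun hy h => hPfar hy _ h (by simp)
  have hnode : ∀ C, ∃ i, ok C → d.head F i = b ∧ ∀ y ∈ C, y ∈ d.A i ∨ d.top y = i := by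
    intro C
    by_cases hC : ok C
    · have hC' := hC
      rw [hok] at hC'
      obtain ⟨j, hj, hCj⟩ := hC'
      -- The bag of the parent of a child's head contains the child's adhesion set, so all profiles
      -- towards `C` can be placed there.
      exact ⟨d.par (d.head F j), fun _ => ⟨hj, fun y hy => d.mem_par _ _ (hCj hy)⟩⟩
    · exact ⟨b, fun h => absurd h hC⟩
  choose node hnode using hnode
  rw [← hP, ← hok]
  let A : I ⊕ (V ⊕ (Finset V × ℕ × (V → ℕ))) → Finset (V ⊕ (Finset V × ℕ × (V → ℕ))) :=
    Sum.elim (fun i => if d.head F i = b ∧ i ≠ b then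
      ((d.A i).filter (· ∈ P)).map Function.Embedding.inl else ∅) fun _ => ∅
  -- Triples that are not profiles are isolated; each gets a node of its own.
  let top : V ⊕ (Finset V × ℕ × (V → ℕ)) → I ⊕ (V ⊕ (Finset V × ℕ × (V → ℕ))) :=
    Sum.elim (fun v => .inl (d.top v)) fun t =>
      if G.IsProfile ok M t.1 t.2.1 t.2.2 then .inl (node t.1) else .inr (.inr t)
  have memA : ∀ {i y}, d.head F i = b → y ∈ d.A i → y ∈ P → .inl y ∈ A (.inl i) := by
    intro i y hi hy hyP
    have hib : i ≠ b := by
      rintro rfl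
      exact hPA hyP hy
    simp only [A, Sum.elim_inl, if_pos (⟨hi, hib⟩ : d.head F i = b ∧ i ≠ b), Finset.mem_map,
      Finset.mem_filter]
    exact ⟨y, ⟨hy, hyP⟩, rfl⟩
  have ofmemA : ∀ {i z}, z ∈ A (.inl i) →
      d.head F i = b ∧ i ≠ b ∧ ∃ y, y ∈ d.A i ∧ y ∈ P ∧ z = .inl y := by
    intro i z hz
    simp only [A, Sum.elim_inl] at hz
    split_ifs at hz with h
    · simp only [Finset.mem_map, Finset.mem_filter] at hz
      obtain ⟨y, ⟨h1, h2⟩, rfl⟩ := hz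
      exact ⟨h.1, h.2, y, h1, h2, rfl⟩
    · simp at hz
  have hhead : ∀ {i}, d.head F i = b → i ≠ b → d.head F (d.par i) = b ∧
      ∃ y ∈ d.A i, ∃ x ∈ d.A b, G.edist y x ≤ F := by
    intro i hi hib
    rcases d.head_cases F i with ⟨h, -, h'⟩ | ⟨h, -⟩
    · rw [← h, hi] at h'
      exact ⟨h.symm.trans hi, h'⟩
    · exact absurd (h.symm.trans hi) hib
  have toptype : ∀ {C r τ}, G.IsProfile ok M C r τ → top (.inr (C, r, τ)) = .inl (node C) :=
    fun h => if_pos h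
  refine ⟨⟨top, Sum.elim (fun i => .inl (d.par i)) .inr, Sum.elim d.dep fun _ => 0, A,
    ?_, ?_, ?_, ?_, ?_⟩⟩
  · rintro (i | i) z hz
    · obtain ⟨hi, hib, y, hy, hyP, rfl⟩ := ofmemA hz
      have hpar := (hhead hi hib).1
      rcases d.mem_par i y hy with h | h
      · exact Or.inl (memA hpar h hyP)
      · exact Or.inr (congrArg Sum.inl h)
    · simp [A] at hz
  · rintro (i | i) ⟨z, hz⟩
    · obtain ⟨-, -, y, hy, -⟩ := ofmemA hz
      exact d.dep_lt i ⟨y, hy⟩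
    · simp [A] at hz
  · rintro (i | i)
    · simp only [A, Sum.elim_inl]
      split_ifs with h
      · rw [Finset.card_map]
        obtain ⟨-, y, hy, x, hx, hyx⟩ := hhead h.1 h.2
        -- This is where the adhesion drops: a non-head node of the block has an adhesion vertex
        -- within `F` of `A b`, which therefore is not in `P`.
        have : ((d.A i).filter (· ∈ P)).card < (d.A i).card := by
          refine Finset.card_lt_card ((Finset.filter_ssubset).2 ⟨y, hy, fun hyP => ?_⟩)
          exact hPfar hyP x hx hyx
        have := d.card_le i
        omega
      · simp
    · simp [A]
  · rintro (i | i)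
    · obtain ⟨s, hs, hsc⟩ := d.fiber i
      obtain ⟨T, hT, hTc⟩ := exists_finset_profiles M (a + 1 + w) (d.A i ∪ s)
        ((Finset.card_union_le _ _).trans (add_le_add (d.card_le i) hsc))
      refine ⟨s.map Function.Embedding.inl ∪ T.map Function.Embedding.inr, ?_, ?_⟩
      · rintro (v | ⟨C, r, τ⟩) hv
        · have hv' : d.top v = i := Sum.inl_injective hv
          refine Finset.mem_union_left _ (Finset.mem_map.2 ⟨v, hs v hv', rfl⟩)
        · refine Finset.mem_union_right _ (Finset.mem_map.2 ⟨(C, r, τ), ?_, rfl⟩)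
          by_cases hp : G.IsProfile ok M C r τ
          · rw [toptype hp] at hv
            have hv' : node C = i := Sum.inl_injective hv
            refine hT _ _ _ (fun y hy => ?_) hp.2.2.1 hp.2.2.2.2.1 hp.2.2.2.2.2
            rw [Finset.mem_union]
            rcases (hnode C hp.1).2 y hy with h | h
            · exact Or.inl (hv' ▸ h)
            · exact Or.inr (hs y (h.trans hv'))
          · simp only [top, Sum.elim_inr, if_neg hp] at hv
            exact absurd hv (by simp)
      · refine (Finset.card_union_le _ _).trans ?_
        rw [Finset.card_map, Finset.card_map]
        exact add_le_add hsc hTc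
    · refine ⟨{i}, ?_, ?_⟩
      · rintro (v | t) hv
        · simp [top] at hv
        · simp only [top, Sum.elim_inr] at hv
          split_ifs at hv
          rw [Finset.mem_singleton]
          exact Sum.inr_injective hv
      · rw [Finset.card_singleton]
        exact le_add_left (Nat.one_le_iff_ne_zero.2 (by positivity))
  · have key : ∀ {p q}, ProfileRel G P ok M p q →
        top p = top q ∨ p ∈ A (top q) ∨ q ∈ A (top p) := by
      intro p q h
      cases h with
      | @vert u v h hu hv =>
        rcases d.adj u v h with h | h | h
        · exact Or.inl (congrArg Sum.inl h)
        · exact Or.inr (Or.inl (memA (hPtop hv) h hu))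
        · exact Or.inr (Or.inr (memA (hPtop hu) h hv))
      | @mix v C r τ hvC hv hp =>
        rw [toptype hp]
        obtain ⟨h1, h2⟩ := hnode C hp.1
        rcases h2 v hvC with h | h
        · exact Or.inr (Or.inl (memA h1 h hv))
        · exact Or.inl (congrArg Sum.inl h)
      | prof h h' => exact Or.inl ((toptype h).trans (toptype h').symm)
    intro p q h
    rw [profileGraph, fromRel_adj] at h
    rcases h.2 with h | h
    · exact key h
    · rcases key h with h | h | h
      · exact Or.inl h.symm
      · exact Or.inr (Or.inr h)
      · exact Or.inr (Or.inl h)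

/-- With empty adhesions each component lies in a single fiber of `top`, so a path in it has at most
`w` vertices. -/
theorem isClusterColoring_of_adhesion_zero (d : TreeDec G 0 w I) (ℓ : ℕ) :
    G.IsClusterColoring ℓ w fun _ => true := by
  classical
  have hA : ∀ i, d.A i = ∅ := fun i => Finset.card_eq_zero.1 (Nat.le_zero.1 (d.card_le i))
  have hadj : ∀ u v, G.Adj u v → d.top u = d.top v := fun u v h => by
    simpa [hA] using d.adj u v h
  intro u v h
  have hr : G.Reachable u v := by
    induction h with
    | refl => exact .rfl
    | tail _ h ih =>
      exact ih.trans (reachable_of_edist_ne_top (h.2.trans_lt (ENat.natCast_lt_top _)).ne)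
  obtain ⟨p, hp, hl⟩ := hr.exists_path_of_dist
  have htop : ∀ {x y} (p : G.Walk x y), ∀ z ∈ p.support, d.top z = d.top x := by
    intro x y p
    induction p with
    | nil => intro z hz; rw [Walk.support_nil, List.mem_singleton] at hz; rw [hz]
    | cons h p ih =>
      intro z hz
      rw [Walk.support_cons, List.mem_cons] at hz
      rcases hz with rfl | hz
      · rfl
      · exact (ih z hz).trans (hadj _ _ h).symm
  obtain ⟨s, hs, hc⟩ := d.fiber (d.top u)
  have hcard : p.support.toFinset.card ≤ s.card := Finset.card_le_card fun z hz =>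
    hs z (htop p z (List.mem_toFinset.1 hz))
  rw [List.toFinset_card_of_nodup hp.support_nodup, Walk.length_support] at hcard
  exact (edist_le p).trans (by exact_mod_cast (by omega : p.length ≤ w))

/-- Graphs with a tree decomposition of bounded width have asymptotic dimension at most one. -/
theorem exists_isClusterColoring (a w ℓ : ℕ) (hℓ : 1 ≤ ℓ) :
    ∃ D : ℕ, ∀ (V I : Type u) (G : SimpleGraph V), TreeDec G a w I →
      ∃ c, G.IsClusterColoring ℓ D c := by
  induction a generalizing w with
  | zero => exact ⟨w, fun V I G d => ⟨_, d.isClusterColoring_of_adhesion_zero ℓ⟩⟩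
  | succ a ih =>
    let M := ℓ * 16 ^ ((a + 1) * (a + 1))
    obtain ⟨D, hD⟩ := ih (w + 2 ^ (a + 1 + w) * ((M + 1) * (M + 1) ^ (a + 1 + w)))
    refine ⟨(fun D => 2 * (D + ℓ + (16 * M + ℓ)))^[a + 1] (D + 13 * M), fun V I G d => ?_⟩
    choose r hr using fun i => G.exists_distance_gap ℓ ((d.toBlockDec (16 * M)).X i)
      ((d.toBlockDec (16 * M)).card_le i)
    choose c hc using fun b => hD _ _ _ (d.exists_treeDec_profileGraph (16 * M) M b).some
    exact ⟨_, BlockDec.isClusterColoring_coloring hr hℓ le_rfl hc⟩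

end TreeDec

/-! ### Circular colorings and the three statements. -/

theorem exists_circularColorable_of_treeWidth_le (k p q : ℕ) (hp : 2 * q < p) :
    ∃ g : ℕ, ∀ (V : Type u) (G : SimpleGraph V), G.treeWidth ≤ (k : ℕ∞) →
      (g : ℕ∞) ≤ G.oddGirth → G.CircularColorable p q := by
  obtain ⟨D, hD⟩ := TreeDec.exists_isClusterColoring.{u} k (k + 1) (2 * (2 * q + 1) + 1) (by omega)
  refine ⟨2 * (D + (2 * q + 1)) + 2, fun V G hk hg => ?_⟩
  obtain ⟨I, ⟨d⟩⟩ := exists_treeDec_of_treeWidth_le hk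
  obtain ⟨c, hc⟩ := hD V I G d
  exact circularColorable_of_isClusterColoring hp hc hg

theorem CircularColorable.circularChromaticNumber_le {p q : ℕ} (hq : 1 ≤ q) (hqp : q ≤ p)
    (h : G.CircularColorable p q) : G.circularChromaticNumber ≤ p / q := by
  refine csInf_le ⟨0, ?_⟩ ⟨p, q, hq, hqp, h, rfl⟩
  rintro _ ⟨p, q, -, -, -, rfl⟩
  positivity

theorem exists_circularChromaticNumber_le (k : ℕ) {ε : ℝ} (hε : 0 < ε) :
    ∃ g : ℕ, ∀ (V : Type u) (G : SimpleGraph V), G.treeWidth ≤ (k : ℕ∞) →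
      (g : ℕ∞) ≤ G.oddGirth → G.circularChromaticNumber ≤ 2 + ε := by
  obtain ⟨n, hn⟩ := exists_nat_one_div_lt hε
  obtain ⟨g, hg⟩ := exists_circularColorable_of_treeWidth_le.{u} k (2 * (n + 1) + 1) (n + 1)
    (by omega)
  refine ⟨g, fun V G hk hG => ?_⟩
  refine ((hg V G hk hG).circularChromaticNumber_le (by omega) (by omega)).trans ?_
  have h0 : (0 : ℝ) < (n : ℝ) + 1 := by positivity
  have : (((2 * (n + 1) + 1 : ℕ) : ℝ) / ((n + 1 : ℕ) : ℝ)) = 2 + 1 / ((n : ℝ) + 1) := by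
    push_cast
    field_simp
  rw [this]
  linarith

end SimpleGraph

theorem theorem2 :
    (∀ (k : ℕ) (ε : ℝ), 0 < ε → ∃ g : ℕ,
      ∀ (V : Type u) [Finite V] (G : SimpleGraph V),
        G.treeWidth ≤ (k : ℕ∞) → (g : ℕ∞) ≤ G.oddGirth →
          G.circularChromaticNumber ≤ 2 + ε) ∧
    (∀ (k p q : ℕ), 0 < q → 2 * q < p → ∃ g : ℕ,
      ∀ (V : Type u) [Finite V] (G : SimpleGraph V),
        G.treeWidth ≤ (k : ℕ∞) → (g : ℕ∞) ≤ G.oddGirth →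
          G.CircularColorable p q) ∧
    (∀ (k : ℕ) (ε : ℝ), 0 < ε → ∃ g : ℕ,
      ∀ (V : Type u) [Finite V] (G : SimpleGraph V) (W : Type v) [Finite W] (H : SimpleGraph W),
        G.treeWidth ≤ (k : ℕ∞) → Nonempty (G →g H) → (g : ℕ∞) ≤ H.egirth →
          G.circularChromaticNumber ≤ 2 + ε) := by
  refine ⟨fun k ε hε => ?_, fun k p q _ hp => ?_, fun k ε hε => ?_⟩
  · obtain ⟨g, hg⟩ := SimpleGraph.exists_circularChromaticNumber_le.{u} k hε
    exact ⟨g, fun V _ G => hg V G⟩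
  · obtain ⟨g, hg⟩ := SimpleGraph.exists_circularColorable_of_treeWidth_le.{u} k p q hp
    exact ⟨g, fun V _ G => hg V G⟩
  · obtain ⟨g, hg⟩ := SimpleGraph.exists_circularChromaticNumber_le.{u} k hε
    exact ⟨g, fun V _ G W _ H hk ⟨f⟩ hH => hg V G hk (SimpleGraph.le_oddGirth_of_hom f hH)⟩
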